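/- Let $f\in C^1([0,1);[0,\infty))$ be nondecreasing with $f^{-1}(0)=\{0\}$. Put $f_1(s):=s\,f(1-s)$ for $s\in(0,1]$, and assume that $f_1$ is strictly decreasing, that $t\mapsto f_1(\sqrt t)$ is convex on $(0,1]$, and that, for some $\ell,\ell_1>0$, $f_1(s)=\ell-\ell_1 s+o(s)$ as $s\to0^+$. For $s\ge 0$ define $$g_0(s):=\inf_{(\alpha,\beta)\in\mathcal U_1}\int_{-\infty}^{\infty}\Big(s^2f^2(\beta)|\alpha'|^2+\frac{(1-\beta)^2}{4}+|\beta'|^2\Big)\,dt,$$ $$\mathcal U_1:=\Big\{(\alpha,\beta)\in H^1_{\rm loc}(\mathbb R)\times H^1_{\rm loc}(\mathbb R):\ \alpha'\in L^1(\mathbb R),\ \Big|\int_{-\infty}^\infty\alpha'\,dt\Big|=1,\ 0\le\beta\le1,\ \lim_{|t|\to\infty}\beta(t)=1\Big\},$$ where $\alpha,\beta$ denote the continuous representatives and $f(1):=+\infty$, with the convention $0\cdot\infty=0$ (so, for $s>0$, the energy is finite only if $\alpha'=0$ a.e. on $\{\beta=1\}$). Then $g_0(s)$ is finite for all $s\ge0$,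 and: (i) $g_0$ is monotone nondecreasing on $[0,\infty)$; (ii) $g_0(s)\le \min\{1,\ell s\}$ for all $s\ge0$, and $\lim_{s\to\infty}g_0(s)=1$; (iii) there exists $\tilde\ell>0$ such that $g_0(s)=\ell s-\tilde\ell s^{5/3}+o(s^{5/3})$ as $s\to0^+$; (iv) $g_0(s_1+s_2)\le g_0(s_1)+g_0(s_2)$ for all $s_1,s_2\ge0$, and the inequality is strict if $s_1,s_2>0$; (v) $g_0$ is Lipschitz continuous on $[0,\infty)$ with Lipschitz constant $\ell$. -/

import Mathlib

open MeasureTheory Filter Set Topology Asymptotics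
open scoped ENNReal ContDiff

namespace CohesiveFracture

/-- `v` is the weak (distributional) derivative of `u` on the real line. -/
structure HasWeakDeriv (u v : ℝ → ℝ) : Prop where
  locallyIntegrable : LocallyIntegrable u volume
  locallyIntegrable_deriv : LocallyIntegrable v volume
  integral_eq : ∀ φ : ℝ → ℝ, ContDiff ℝ ∞ φ → HasCompactSupport φ →
    ∫ t, u t * deriv φ t = -∫ t, v t * φ t

/-- Local square integrability on the real line. -/
def IsL2Loc (u : ℝ → ℝ) : Prop :=
  ∀ K : Set ℝ, IsCompact K → MemLp u 2 (volume.restrict K)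

/-- `u` is the continuous representative of an element of `H¹_loc(ℝ)`, with weak derivative `v`. -/
structure IsH1LocWithDeriv (u v : ℝ → ℝ) : Prop where
  continuous : Continuous u
  isL2Loc : IsL2Loc u
  isL2Loc_deriv : IsL2Loc v
  hasWeakDeriv : HasWeakDeriv u v

/-- The class `U₁` of admissible pairs `(α, β)`, together with their weak derivatives
`(α', β')`; these are determined by `α` and `β` up to null sets. -/
structure Admissible (α α' β β' : ℝ → ℝ) : Prop where
  h1loc_fst : IsH1LocWithDeriv α α'
  h1loc_snd : IsH1LocWithDeriv β β'
  integrable_deriv : Integrable α' volume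
  abs_integral_deriv : |∫ t, α' t| = 1
  mem_Icc : ∀ t, β t ∈ Icc (0 : ℝ) 1
  tendsto_one : Tendsto β (cocompact ℝ) (𝓝 1)

/-- A function `f` on `[0,1)`, extended by the value `∞` at the point `1` (the functions `f`
considered blow up there). -/
noncomputable def extendTop (f : ℝ → ℝ) (b : ℝ) : ℝ≥0∞ :=
  open Classical in if b < 1 then ENNReal.ofReal (f b) else ⊤

/-- The profile energy `∫ (s² f(β)² |α'|² + (1 - β)² / 4 + |β'|²) dt` as a number in `[0, ∞]`.
The usual convention `0 * ∞ = 0` applies to the first term. -/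
noncomputable def profileEnergy (f : ℝ → ℝ) (s : ℝ) (α' β β' : ℝ → ℝ) : ℝ≥0∞ :=
  ∫⁻ t, (ENNReal.ofReal (s ^ 2) * extendTop f (β t) ^ 2 * ENNReal.ofReal (|α' t| ^ 2)
    + ENNReal.ofReal ((1 - β t) ^ 2 / 4) + ENNReal.ofReal (|β' t| ^ 2))

/-- The infimum of the profile energy over all admissible pairs, in `[0, ∞]`. -/
noncomputable def infEnergy (f : ℝ → ℝ) (s : ℝ) : ℝ≥0∞ :=
  ⨅ (α : ℝ → ℝ) (α' : ℝ → ℝ) (β : ℝ → ℝ) (β' : ℝ → ℝ) (_ : Admissible α α' β β'),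
    profileEnergy f s α' β β'

/-- The optimal-profile cohesive energy, as a real number. -/
noncomputable def g₀ (f : ℝ → ℝ) (s : ℝ) : ℝ := (infEnergy f s).toReal

/-- The function `f₁(s) = s f(1 - s)`, used for `s ∈ (0, 1]`. -/
def f₁ (f : ℝ → ℝ) (s : ℝ) : ℝ := s * f (1 - s)

/-- The standing assumptions on `f : [0,1) → [0,∞)`; values of `f` outside `[0,1)` are
irrelevant. -/
structure IsDegradation (f : ℝ → ℝ) (ℓ ℓ₁ : ℝ) : Prop where
  contDiffOn : ContDiffOn ℝ 1 f (Ico 0 1)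
  nonneg : ∀ x ∈ Ico (0 : ℝ) 1, 0 ≤ f x
  monotoneOn : MonotoneOn f (Ico 0 1)
  zero_iff : ∀ x ∈ Ico (0 : ℝ) 1, f x = 0 ↔ x = 0
  strictAntiOn : StrictAntiOn (f₁ f) (Ioc 0 1)
  convexOn : ConvexOn ℝ (Ioc 0 1) (fun t => f₁ f (Real.sqrt t))
  slope_pos : 0 < ℓ
  slope_deriv_pos : 0 < ℓ₁
  expansion : (fun s => f₁ f s - (ℓ - ℓ₁ * s)) =o[𝓝[>] 0] (fun s : ℝ => s)

end CohesiveFracture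

/-!
Write `u = 1 - β` for the profile of an admissible pair, so that `f(β) = f₁(u) / u`, and put
`D = ∫ u²`, `I = ∫ u³`, `K = ∫ u'²`. The phase field part of the energy is `D / 4 + K`.

*Elementary estimates.* Integrating `(u²)' = 2 u u'` from a point to both ends of the line
gives `2 μ u(x)² ≤ μ² D + K` for all `μ` (`IsProfile.two_mul_mul_sq_le`), hence the bound
`u(x)² ≤ D / 4 + K`, the bound `u(x)⁴ ≤ D K`, and the Gagliardo–Nirenberg inequality `I⁴ ≤ D⁵ K`.
If `u ≤ r`, then the elastic term and `u² / 4` together cost at least `s f₁(r)`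
(`Admissible.mul_f₁_le`). So the energy is at least `min (r²) (s f₁(r))` for every `r < 1`, which
gives the limit at infinity. The bound `g₀ ≤ 1` comes from `u = exp (-|t| / 2)`.

*Scaling.* Stretching a pair by the factor `λ ≥ 1` and multiplying the opening `s` by `λ` turns the
energy `E` into `λ E - (λ - 1 / λ) K` (`profileEnergy_rescale`), so `g₀(λ s) ≤ λ g₀(s)`. If
`g₀(s) < ℓ s`, then nearly optimal profiles cannot be uniformly small, because
`s f₁(r) → s ℓ` as `r → 0`; hence `K` is bounded from below along them and the inequality is strict for
`λ > 1` (`mul_g₀_div_lt`). Strict subadditivity follows because `g₀(s) / s` is then strictly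
decreasing, and with monotonicity and `g₀(s) ≤ ℓ s` it gives the Lipschitz bound.

*Expansion at zero.* With `κ = ℓ₁ / (2 ℓ)`, the pointwise inequality
`s² f² α'² ≥ s ℓ |α'| - ℓ² / (4 f²)` and `ℓ² / f² ≈ u² + 4 κ u³` show that the energy is at least
`ℓ s - κ I + K` to leading order (`Admissible.linearised_le`); comparison with `ℓ s` also gives
`D ≤ 2 ℓ s` to leading order. The quantities `κ I - K` and `D^{5/3}` scale in the same way under
`u ↦ σ² u(σ ·)`, and `cubicConst κ` is the finite, positive supremum of their quotient. Hence
`ℓ s - cubicConst κ (2 ℓ s)^{5/3}` is a lower bound up to `o(s^{5/3})` (`eventually_le_g₀`); the errors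
in `κ` are harmless because `cubicConst` is convex and therefore continuous. The matching upper bound
(`eventually_g₀_le`) uses the rescaled near-maximisers with `∫ u² = 2 ℓ s` and `α'` proportional to
`u² + 4 κ u³`. In particular `g₀(s) < ℓ s` for small `s`, hence for all `s > 0` by scaling.
-/

/-! ### Weak derivatives on the line as integrands of primitives -/

namespace CohesiveFracture

/-- `u` is a primitive of the locally integrable function `v`, that is, `u` is locally absolutely
continuous and `u' = v` almost everywhere. -/
structure IsPrimitive (u v : ℝ → ℝ) : Prop where
  locallyIntegrable : LocallyIntegrable v volume
  integral_eq : ∀ x y, ∫ t in x..y, v t = u y - u x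

theorem _root_.MeasureTheory.LocallyIntegrable.intervalIntegrable_real {v : ℝ → ℝ}
    (hv : LocallyIntegrable v volume) (x y : ℝ) : IntervalIntegrable v volume x y :=
  intervalIntegrable_iff.mpr
    ((hv.integrableOn_isCompact isCompact_uIcc).mono_set uIoc_subset_uIcc)

namespace IsPrimitive

variable {u v : ℝ → ℝ}

theorem intervalIntegrable (h : IsPrimitive u v) (x y : ℝ) : IntervalIntegrable v volume x y :=
  h.locallyIntegrable.intervalIntegrable_real x y

theorem eq_add_integral (h : IsPrimitive u v) (a : ℝ) :
    u = fun x => u a + ∫ t in a..x, v t := by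
  funext x
  rw [h.integral_eq]
  ring

theorem continuous (h : IsPrimitive u v) : Continuous u := by
  rw [h.eq_add_integral 0]
  exact continuous_const.add (intervalIntegral.continuous_primitive h.intervalIntegrable 0)

theorem absolutelyContinuousOnInterval (h : IsPrimitive u v) (a b : ℝ) :
    AbsolutelyContinuousOnInterval u a b := by
  have h1 := (h.intervalIntegrable a b).absolutelyContinuousOnInterval_intervalIntegral
    (c := a) (by simp)
  have h2 : AbsolutelyContinuousOnInterval (fun _ : ℝ => u a) a b :=
    ((LipschitzWith.const (u a)).lipschitzOnWith (s := uIcc a b)).absolutelyContinuousOnInterval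
  rw [h.eq_add_integral a]
  exact h2.fun_add h1

theorem ae_hasDerivAt (h : IsPrimitive u v) : ∀ᵐ x, HasDerivAt u (v x) x := by
  filter_upwards [_root_.LocallyIntegrable.ae_hasDerivAt_integral h.locallyIntegrable] with x hx
  rw [h.eq_add_integral 0]
  exact (hx 0).const_add _

/-- The chain rule for the square of an absolutely continuous function, in integrated form. -/
theorem integral_mul_self (h : IsPrimitive u v) (x y : ℝ) :
    ∫ t in x..y, 2 * (u t * v t) = u y ^ 2 - u x ^ 2 := by
  have h1 := (h.absolutelyContinuousOnInterval x y).integral_deriv_mul_eq_sub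
    (h.absolutelyContinuousOnInterval x y)
  rw [show u y ^ 2 - u x ^ 2 = u y * u y - u x * u x by ring, ← h1]
  apply intervalIntegral.integral_congr_ae
  filter_upwards [h.ae_hasDerivAt] with t ht _
  rw [ht.deriv]
  ring

theorem hasWeakDeriv (h : IsPrimitive u v) : HasWeakDeriv u v := by
  refine ⟨h.continuous.locallyIntegrable, h.locallyIntegrable, fun φ hφ hc => ?_⟩
  obtain ⟨R, hR⟩ := hc.isCompact.isBounded.subset_closedBall 0
  have hsub : tsupport φ ⊆ Ioc (-(|R| + 1)) (|R| + 1) := by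
    intro x hx
    have := hR hx
    rw [mem_closedBall_zero_iff, Real.norm_eq_abs] at this
    have h2 := abs_le.mp (this.trans (le_abs_self R))
    constructor <;> linarith [h2.1, h2.2]
  set r := |R| + 1
  have hφr : φ r = 0 := by
    by_contra hne
    have h1 := hR (subset_tsupport φ hne)
    rw [mem_closedBall_zero_iff, Real.norm_eq_abs] at h1
    have : |r| = |R| + 1 := abs_of_pos (by positivity)
    linarith [le_abs_self R]
  have hφr' : φ (-r) = 0 := by
    by_contra hne
    have h1 := hR (subset_tsupport φ hne)
    rw [mem_closedBall_zero_iff, Real.norm_eq_abs, abs_neg] at h1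
    have : |r| = |R| + 1 := abs_of_pos (by positivity)
    linarith [le_abs_self R]
  have hφp : IsPrimitive φ (deriv φ) := by
    have hcd : Continuous (deriv φ) := hφ.continuous_deriv (by simp)
    refine ⟨hcd.locallyIntegrable, fun x y => ?_⟩
    exact intervalIntegral.integral_deriv_eq_sub
      (fun z _ => (hφ.differentiable (by simp)).differentiableAt) (hcd.intervalIntegrable x y)
  have key := (h.absolutelyContinuousOnInterval (-r) r).integral_mul_deriv_eq_deriv_mul
    (hφp.absolutelyContinuousOnInterval (-r) r)
  rw [hφr, hφr'] at key
  have e1 : ∫ t in (-r)..r, u t * deriv φ t = ∫ t, u t * deriv φ t := by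
    apply intervalIntegral.integral_eq_integral_of_support_subset
    intro x hx
    exact hsub (support_deriv_subset (right_ne_zero_of_mul hx))
  have e2 : ∫ t in (-r)..r, deriv u t * φ t = ∫ t, v t * φ t := by
    rw [← intervalIntegral.integral_eq_integral_of_support_subset (a := -r) (b := r)
      (f := fun t => v t * φ t)]
    · apply intervalIntegral.integral_congr_ae
      filter_upwards [h.ae_hasDerivAt] with t ht _
      rw [ht.deriv]
    · intro x hx
      exact hsub (subset_tsupport φ (right_ne_zero_of_mul hx))
  rw [← e1, key, e2]
  ring

end IsPrimitive

/-- A continuous function whose distributional derivative vanishes is constant. -/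
theorem eq_const_of_integral_mul_deriv_eq_zero {w : ℝ → ℝ} (hw : Continuous w)
    (h : ∀ φ : ℝ → ℝ, ContDiff ℝ ∞ φ → HasCompactSupport φ → ∫ t, w t * deriv φ t = 0) :
    ∃ c, ∀ x, w x = c := by
  let b : ContDiffBump (0 : ℝ) := ⟨1, 2, by norm_num, by norm_num⟩
  let ρ : ℝ → ℝ := b.normed volume
  have hρ : ContDiff ℝ ∞ ρ := b.contDiff_normed
  have hρc : HasCompactSupport ρ := b.hasCompactSupport_normed
  have hρ1 : ∫ t, ρ t = 1 := b.integral_normed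
  have hint : ∀ ψ : ℝ → ℝ, ContDiff ℝ ∞ ψ → HasCompactSupport ψ →
      Integrable (fun t => w t * ψ t) := fun ψ hψ hc =>
    (hw.mul hψ.continuous).integrable_of_hasCompactSupport hc.mul_left
  refine ⟨∫ t, w t * ρ t, ?_⟩
  set c := ∫ t, w t * ρ t with hc_def
  have hae : ∀ᵐ x, w x = c := by
    refine ae_eq_of_integral_contDiff_smul_eq hw.locallyIntegrable
      continuous_const.locallyIntegrable fun ψ hψ hψc => ?_
    set m := ∫ t, ψ t
    -- a test function of zero mean is the derivative of a test function
    let η : ℝ → ℝ := fun t => ψ t - m * ρ t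
    have hη : ContDiff ℝ ∞ η := hψ.sub (contDiff_const.mul hρ)
    have hηc : HasCompactSupport η := hψc.sub hρc.mul_left
    have hψi : Integrable ψ := hψ.continuous.integrable_of_hasCompactSupport hψc
    have hρi : Integrable ρ := hρ.continuous.integrable_of_hasCompactSupport hρc
    have hη0 : ∫ t, η t = 0 := by
      rw [integral_sub hψi (hρi.const_mul m), integral_const_mul, hρ1]
      simp [m]
    obtain ⟨R, hR⟩ := hηc.isCompact.isBounded.subset_closedBall 0
    have hz : ∀ x, |R| < |x| → η x = 0 := by
      intro x hx
      by_contra hne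
      have h1 := hR (subset_tsupport η hne)
      rw [mem_closedBall_zero_iff, Real.norm_eq_abs] at h1
      linarith [le_abs_self R]
    have hRR : |R| < |R| + 1 := by linarith
    let φ : ℝ → ℝ := fun x => ∫ t in (-(|R| + 1))..x, η t
    have hder : ∀ x, HasDerivAt φ (η x) x := fun x =>
      intervalIntegral.integral_hasDerivAt_right (hη.continuous.intervalIntegrable _ _)
        hη.continuous.stronglyMeasurable.stronglyMeasurableAtFilter hη.continuous.continuousAt
    have hφ' : deriv φ = η := funext fun x => (hder x).deriv
    have hφ : ContDiff ℝ ∞ φ := by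
      rw [contDiff_infty_iff_deriv]
      exact ⟨fun x => (hder x).differentiableAt, by rw [hφ']; exact hη⟩
    have hφc : HasCompactSupport φ := by
      refine HasCompactSupport.intro (isCompact_Icc (a := -(|R| + 1)) (b := |R| + 1)) ?_
      intro x hx
      rw [mem_Icc, not_and_or, not_le, not_le] at hx
      rcases hx with hx | hx
      · have : ∫ t in (-(|R| + 1))..x, η t = ∫ t in (-(|R| + 1))..x, (0 : ℝ) := by
          apply intervalIntegral.integral_congr
          intro t ht
          rw [uIcc_of_ge hx.le] at ht
          apply hz
          have : t ≤ -(|R| + 1) := ht.2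
          linarith [neg_le_abs t]
        simpa [φ] using this
      · have : φ x = ∫ t, η t := by
          apply intervalIntegral.integral_eq_integral_of_support_subset
          intro t ht
          have h1 : |t| ≤ |R| := by
            by_contra hcon
            exact ht (hz t (not_le.mp hcon))
          have h2 := abs_le.mp h1
          constructor <;> linarith [h2.1, h2.2]
        rw [this, hη0]
    have key := h φ hφ hφc
    rw [hφ'] at key
    have e : ∫ t, w t * η t = (∫ t, w t * ψ t) - m * c := by
      rw [hc_def, ← integral_const_mul,
        ← integral_sub (hint ψ hψ hψc) ((hint ρ hρ hρc).const_mul m)]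
      congr 1
      funext t
      simp only [η]
      ring
    have e1 : ∫ t, ψ t • w t = ∫ t, w t * ψ t := by simp_rw [smul_eq_mul, mul_comm]
    have e2 : ∫ t, ψ t • c = m * c := by simp_rw [smul_eq_mul, integral_mul_const]; rfl
    rw [e1, e2]
    linarith
  have := (Continuous.ae_eq_iff_eq volume hw (continuous_const (y := c))).mp hae
  exact fun x => congrFun this x

theorem HasWeakDeriv.isPrimitive {u v : ℝ → ℝ} (h : HasWeakDeriv u v) (hu : Continuous u) :
    IsPrimitive u v := by
  have hv := h.locallyIntegrable_deriv
  let V : ℝ → ℝ := fun x => ∫ t in (0 : ℝ)..x, v t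
  have hV : IsPrimitive V v := by
    refine ⟨hv, fun x y => ?_⟩
    exact (intervalIntegral.integral_interval_sub_left (hv.intervalIntegrable_real 0 y)
      (hv.intervalIntegrable_real 0 x)).symm
  obtain ⟨c, hc⟩ := eq_const_of_integral_mul_deriv_eq_zero (w := fun x => u x - V x)
    (hu.sub hV.continuous) fun φ hφ hφc => by
      have hd : Continuous (deriv φ) := hφ.continuous_deriv (by simp)
      have hdc : HasCompactSupport (deriv φ) := hφc.deriv
      simp_rw [sub_mul]
      have h1 : Integrable fun t => u t * deriv φ t :=
        (hu.mul hd).integrable_of_hasCompactSupport hdc.mul_left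
      have h2 : Integrable fun t => V t * deriv φ t :=
        (hV.continuous.mul hd).integrable_of_hasCompactSupport hdc.mul_left
      rw [integral_sub h1 h2, h.integral_eq φ hφ hφc, hV.hasWeakDeriv.integral_eq φ hφ hφc, sub_self]
  refine ⟨hv, fun x y => ?_⟩
  rw [hV.integral_eq]
  linarith [hc x, hc y]

theorem _root_.Continuous.isL2Loc {u : ℝ → ℝ} (hu : Continuous u) : IsL2Loc u := by
  intro K hK
  have : IsFiniteMeasure (volume.restrict K) := ⟨by simpa using hK.measure_lt_top⟩
  obtain ⟨C, hC⟩ := (hK.image hu).isBounded.exists_norm_le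
  refine MemLp.of_bound hu.aestronglyMeasurable C ?_
  exact ae_restrict_of_forall_mem hK.measurableSet fun x hx => hC _ (mem_image_of_mem u hx)

/-- For continuous functions, weak derivatives are exactly the integrands of primitives; all
later arguments use the right-hand side only. -/
theorem isH1LocWithDeriv_iff {u v : ℝ → ℝ} :
    IsH1LocWithDeriv u v ↔ IsPrimitive u v ∧ IsL2Loc v := by
  constructor
  · intro h
    exact ⟨h.hasWeakDeriv.isPrimitive h.continuous, h.isL2Loc_deriv⟩
  · rintro ⟨h, hv⟩
    exact ⟨h.continuous, h.continuous.isL2Loc, hv, h.hasWeakDeriv⟩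

theorem IsL2Loc.locallyIntegrable {v : ℝ → ℝ} (hv : IsL2Loc v) : LocallyIntegrable v volume := by
  rw [locallyIntegrable_iff]
  intro K hK
  have : IsFiniteMeasure (volume.restrict K) := ⟨by simpa using hK.measure_lt_top⟩
  exact (hv K hK).integrable (by norm_num)

theorem _root_.MeasureTheory.MemLp.isL2Loc {v : ℝ → ℝ} (hv : MemLp v 2 volume) : IsL2Loc v :=
  fun K _ => hv.restrict K

/-- The primitive of a function in `L²_loc`, normalised at `0`. -/
theorem IsL2Loc.isPrimitive {v : ℝ → ℝ} (hv : IsL2Loc v) :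
    IsPrimitive (fun x => ∫ t in (0 : ℝ)..x, v t) v :=
  ⟨hv.locallyIntegrable, fun x y =>
    (intervalIntegral.integral_interval_sub_left
      (hv.locallyIntegrable.intervalIntegrable_real 0 y)
      (hv.locallyIntegrable.intervalIntegrable_real 0 x)).symm⟩

end CohesiveFracture

/-! ### Nonnegative `H¹` profiles and their Sobolev inequalities -/

namespace CohesiveFracture

theorem memLp_comp_mul_left {v : ℝ → ℝ} {K : Set ℝ} {c : ℝ} (hc : c ≠ 0)
    (hv : MemLp v 2 (volume.restrict ((fun t => c * t) '' K))) :
    MemLp (fun t => v (c * t)) 2 (volume.restrict K) := by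
  let e : ℝ ≃ᵐ ℝ := (Homeomorph.mulLeft₀ c hc).toMeasurableEquiv
  have he : (e : ℝ → ℝ) = fun t => c * t := rfl
  have hmap : Measure.map e (volume.restrict K)
      = ENNReal.ofReal |c⁻¹| • volume.restrict ((fun t => c * t) '' K) := by
    have h1 : K = e ⁻¹' (e '' K) := (e.injective.preimage_image K).symm
    rw [← he]
    conv_lhs => rw [h1]
    rw [← e.measurableEmbedding.restrict_map]
    rw [he, Real.map_volume_mul_left hc, Measure.restrict_smul]
  have h2 : MemLp v 2 (Measure.map e (volume.restrict K)) := by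
    rw [hmap]
    exact hv.smul_measure ENNReal.ofReal_ne_top
  exact (e.memLp_map_measure_iff).mp h2

theorem IsL2Loc.comp_mul_left {v : ℝ → ℝ} (hv : IsL2Loc v) {c : ℝ} (hc : c ≠ 0) :
    IsL2Loc fun t => v (c * t) := fun _ hK =>
  memLp_comp_mul_left hc (hv _ (hK.image (continuous_const.mul continuous_id)))

theorem IsL2Loc.const_mul {v : ℝ → ℝ} (hv : IsL2Loc v) (c : ℝ) :
    IsL2Loc fun t => c * v t := fun _ hK => (hv _ hK).const_mul c

theorem IsL2Loc.neg {v : ℝ → ℝ} (hv : IsL2Loc v) :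
    IsL2Loc fun t => - v t := fun _ hK => (hv _ hK).neg

namespace IsPrimitive

variable {u v : ℝ → ℝ}

theorem comp_mul_left (h : IsPrimitive u v) (hv : IsL2Loc v) {c : ℝ} (hc : c ≠ 0) :
    IsPrimitive (fun t => u (c * t)) (fun t => c * v (c * t)) := by
  refine ⟨((hv.comp_mul_left hc).const_mul c).locallyIntegrable, fun x y => ?_⟩
  rw [intervalIntegral.integral_const_mul, intervalIntegral.mul_integral_comp_mul_left,
    h.integral_eq]

theorem const_mul (h : IsPrimitive u v) (a : ℝ) :
    IsPrimitive (fun t => a * u t) (fun t => a * v t) := by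
  refine ⟨h.locallyIntegrable.smul a, fun x y => ?_⟩
  rw [intervalIntegral.integral_const_mul, h.integral_eq, mul_sub]

theorem const_sub (h : IsPrimitive u v) (a : ℝ) :
    IsPrimitive (fun t => a - u t) (fun t => - v t) := by
  refine ⟨h.locallyIntegrable.neg, fun x y => ?_⟩
  rw [intervalIntegral.integral_neg, h.integral_eq]
  ring

end IsPrimitive

/-- Nonnegative functions in `H¹(ℝ)`, together with their weak derivative. They describe the
profile `u = 1 - β` of the phase field around a crack. Decay at infinity is automatic for
elements of `H¹(ℝ)`; it is recorded for convenience. -/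
structure IsProfile (u v : ℝ → ℝ) : Prop where
  isPrimitive : IsPrimitive u v
  memLp : MemLp u 2 volume
  memLp_deriv : MemLp v 2 volume
  nonneg : ∀ t, 0 ≤ u t
  tendsto_zero : Tendsto u (cocompact ℝ) (𝓝 0)

namespace IsProfile

variable {u v : ℝ → ℝ}

theorem continuous (h : IsProfile u v) : Continuous u := h.isPrimitive.continuous

theorem integrable_sq (h : IsProfile u v) : Integrable (fun t => u t ^ 2) := h.memLp.integrable_sq

theorem integrable_deriv_sq (h : IsProfile u v) : Integrable (fun t => v t ^ 2) :=
  h.memLp_deriv.integrable_sq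

/-- The one-dimensional Sobolev inequality in additive form: integrate `(u²)' = 2 u u'` from
`x` to both ends of the line. -/
theorem two_mul_mul_sq_le (h : IsProfile u v) (μ x : ℝ) :
    2 * μ * u x ^ 2 ≤ μ ^ 2 * (∫ t, u t ^ 2) + ∫ t, v t ^ 2 := by
  let F : ℝ → ℝ := fun t => μ ^ 2 * u t ^ 2 + v t ^ 2
  have hF : Integrable F := (h.integrable_sq.const_mul _).add h.integrable_deriv_sq
  have hF0 : ∀ t, 0 ≤ F t := fun t => by positivity
  have hFi : ∫ t, F t = μ ^ 2 * (∫ t, u t ^ 2) + ∫ t, v t ^ 2 := by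
    rw [integral_add (h.integrable_sq.const_mul _) h.integrable_deriv_sq, integral_const_mul]
  have hI : ∀ a b, IntervalIntegrable (fun t => 2 * (u t * v t)) volume a b := fun a b =>
    ((h.isPrimitive.intervalIntegrable a b).continuousOn_mul h.continuous.continuousOn).const_mul 2
  have bound : ∀ a b, a ≤ b → |μ * (u b ^ 2 - u a ^ 2)| ≤ ∫ t in a..b, F t := by
    intro a b hab
    rw [← h.isPrimitive.integral_mul_self, ← intervalIntegral.integral_const_mul]
    refine (intervalIntegral.abs_integral_le_integral_abs hab).trans ?_
    refine intervalIntegral.integral_mono_on hab ((hI a b).const_mul μ).abs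
      hF.intervalIntegrable fun t _ => ?_
    simp only [F]
    rw [abs_le]
    constructor
    · nlinarith [sq_nonneg (μ * u t + v t)]
    · nlinarith [sq_nonneg (μ * u t - v t)]
  have htop : Tendsto u atTop (𝓝 0) :=
    h.tendsto_zero.mono_left (by rw [cocompact_eq_atBot_atTop]; exact le_sup_right)
  have hbot : Tendsto u atBot (𝓝 0) :=
    h.tendsto_zero.mono_left (by rw [cocompact_eq_atBot_atTop]; exact le_sup_left)
  have hright : μ * u x ^ 2 ≤ ∫ t in Ioi x, F t := by
    have l1 : Tendsto (fun b => μ * (u x ^ 2 - u b ^ 2)) atTop (𝓝 (μ * (u x ^ 2 - 0 ^ 2))) :=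
      (tendsto_const_nhds.sub (htop.pow 2)).const_mul μ
    have l2 := intervalIntegral_tendsto_integral_Ioi x hF.integrableOn tendsto_id
    have := le_of_tendsto_of_tendsto l1 l2 (by
      filter_upwards [eventually_ge_atTop x] with b hb
      have := (abs_le.mp (bound x b hb)).1
      simp only [id]
      linarith)
    simpa using this
  have hleft : μ * u x ^ 2 ≤ ∫ t in Iic x, F t := by
    have l1 : Tendsto (fun b => μ * (u x ^ 2 - u b ^ 2)) atBot (𝓝 (μ * (u x ^ 2 - 0 ^ 2))) :=
      (tendsto_const_nhds.sub (hbot.pow 2)).const_mul μ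
    have l2 := intervalIntegral_tendsto_integral_Iic x hF.integrableOn tendsto_id
    have := le_of_tendsto_of_tendsto l1 l2 (by
      filter_upwards [eventually_le_atBot x] with b hb
      have := (abs_le.mp (bound b x hb)).2
      simp only [id]
      linarith)
    simpa using this
  have hsplit := intervalIntegral.integral_Iic_add_Ioi (b := x) hF.integrableOn hF.integrableOn
  rw [← hFi, ← hsplit]
  linarith

/-- The height of a profile is controlled by its phase field energy; the constant is sharp for
`exp (-|t| / 2)`. -/
theorem sq_le (h : IsProfile u v) (x : ℝ) :
    u x ^ 2 ≤ (∫ t, u t ^ 2) / 4 + ∫ t, v t ^ 2 := by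
  have := h.two_mul_mul_sq_le (1 / 2) x
  linarith

/-- The multiplicative form of the Sobolev inequality, from the optimal choice of `μ`. -/
theorem pow_four_le (h : IsProfile u v) (x : ℝ) :
    u x ^ 4 ≤ (∫ t, u t ^ 2) * ∫ t, v t ^ 2 := by
  -- the quadratic polynomial `μ² D - 2 μ u(x)² + K` is nonnegative
  have := discrim_le_zero (a := ∫ t, u t ^ 2) (b := -(2 * u x ^ 2)) (c := ∫ t, v t ^ 2) fun μ => by
    linarith [h.two_mul_mul_sq_le μ x]
  rw [discrim] at this
  nlinarith

theorem cube_le {m : ℝ} (hm : ∀ t, u t ≤ m) (t : ℝ) :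
    u t ^ 3 ≤ m * u t ^ 2 := by
  nlinarith [mul_le_mul_of_nonneg_right (hm t) (sq_nonneg (u t))]

theorem exists_bound (h : IsProfile u v) : ∃ m, 0 ≤ m ∧ ∀ t, u t ≤ m := by
  refine ⟨√((∫ t, u t ^ 2) / 4 + ∫ t, v t ^ 2), Real.sqrt_nonneg _, fun t => ?_⟩
  exact Real.le_sqrt_of_sq_le (h.sq_le t)

theorem integrable_cube (h : IsProfile u v) : Integrable (fun t => u t ^ 3) := by
  obtain ⟨m, _, hm⟩ := h.exists_bound
  refine (h.integrable_sq.const_mul m).mono' (h.continuous.pow 3).aestronglyMeasurable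
    (Eventually.of_forall fun t => ?_)
  rw [Real.norm_of_nonneg (pow_nonneg (h.nonneg t) 3)]
  exact cube_le hm t

theorem integral_cube_le (h : IsProfile u v) {m : ℝ} (hm : ∀ t, u t ≤ m) :
    ∫ t, u t ^ 3 ≤ m * ∫ t, u t ^ 2 := by
  rw [← integral_const_mul]
  exact integral_mono h.integrable_cube (h.integrable_sq.const_mul m) (cube_le hm)

theorem integral_cube_nonneg (h : IsProfile u v) : 0 ≤ ∫ t, u t ^ 3 :=
  integral_nonneg fun t => pow_nonneg (h.nonneg t) 3

/-- A Gagliardo–Nirenberg inequality. -/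
theorem integral_cube_pow_four_le (h : IsProfile u v) :
    (∫ t, u t ^ 3) ^ 4 ≤ (∫ t, u t ^ 2) ^ 5 * ∫ t, v t ^ 2 := by
  set D := ∫ t, u t ^ 2
  set K := ∫ t, v t ^ 2
  have hK : 0 ≤ K := integral_nonneg fun t => sq_nonneg _
  have hD : 0 ≤ D := integral_nonneg fun t => sq_nonneg _
  have hm : ∀ t, u t ≤ √(√(D * K)) := fun t => by
    refine Real.le_sqrt_of_sq_le (Real.le_sqrt_of_sq_le ?_)
    calc (u t ^ 2) ^ 2 = u t ^ 4 := by ring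
      _ ≤ D * K := h.pow_four_le t
  have hm4 : √(√(D * K)) ^ 4 = D * K := by
    rw [show √(√(D * K)) ^ 4 = (√(√(D * K)) ^ 2) ^ 2 by ring, Real.sq_sqrt (Real.sqrt_nonneg _),
      Real.sq_sqrt (mul_nonneg hD hK)]
  calc (∫ t, u t ^ 3) ^ 4 ≤ (√(√(D * K)) * D) ^ 4 :=
        pow_le_pow_left₀ h.integral_cube_nonneg (h.integral_cube_le hm) 4
    _ = D ^ 5 * K := by rw [mul_pow, hm4]; ring

theorem rescale (h : IsProfile u v) {a c : ℝ} (ha : 0 ≤ a) (hc : 0 < c) :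
    IsProfile (fun t => a * u (c * t)) (fun t => a * (c * v (c * t))) := by
  have hu : ∀ {w : ℝ → ℝ}, MemLp w 2 volume → MemLp (fun t => w (c * t)) 2 volume := by
    intro w hw
    rw [← Measure.restrict_univ (μ := volume)]
    exact memLp_comp_mul_left hc.ne' (hw.restrict _)
  refine ⟨(h.isPrimitive.comp_mul_left h.memLp_deriv.isL2Loc hc.ne').const_mul a,
    (hu h.memLp).const_mul a, ((hu h.memLp_deriv).const_mul c).const_mul a,
    fun t => mul_nonneg ha (h.nonneg _), ?_⟩
  have := (h.tendsto_zero.comp (tendsto_cocompact_mul_left₀ hc.ne')).const_mul a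
  simpa using this

theorem integral_rescale_pow (a : ℝ) {c : ℝ} (hc : 0 < c) (n : ℕ) :
    ∫ t, (a * u (c * t)) ^ n = a ^ n / c * ∫ t, u t ^ n := by
  simp_rw [mul_pow]
  rw [integral_const_mul, Measure.integral_comp_mul_left (fun t => u t ^ n) c,
    abs_of_pos (inv_pos.mpr hc), smul_eq_mul]
  ring

end IsProfile

/-- The derivative of `exp (-|t|)`, with its right-hand value at the kink. -/
noncomputable def expNegAbsDeriv (t : ℝ) : ℝ :=
  if t < 0 then Real.exp (-|t|) else -Real.exp (-|t|)

theorem expNegAbsDeriv_sq (t : ℝ) : expNegAbsDeriv t ^ 2 = Real.exp (-|t|) ^ 2 := by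
  unfold expNegAbsDeriv
  split_ifs <;> ring

theorem integral_exp_neg_abs_sq : ∫ t : ℝ, Real.exp (-|t|) ^ 2 = 1 := by
  have h : ∀ t : ℝ, Real.exp (-|t|) ^ 2 = Real.exp (-2 * |t|) := fun t => by
    rw [← Real.exp_nat_mul]
    congr 1
    push_cast
    ring
  simp_rw [h]
  rw [integral_comp_abs (f := fun x => Real.exp (-2 * x)), integral_exp_mul_Ioi (by norm_num)]
  norm_num

theorem isProfile_exp_neg_abs : IsProfile (fun t => Real.exp (-|t|)) expNegAbsDeriv := by
  have hc : Continuous fun t : ℝ => Real.exp (-|t|) := by fun_prop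
  have hm : Measurable expNegAbsDeriv :=
    Measurable.ite measurableSet_Iio hc.measurable hc.measurable.neg
  have hsq : Integrable fun t : ℝ => Real.exp (-|t|) ^ 2 :=
    Integrable.of_integral_ne_zero (by rw [integral_exp_neg_abs_sq]; norm_num)
  have hv : MemLp expNegAbsDeriv 2 volume := by
    rw [memLp_two_iff_integrable_sq hm.aestronglyMeasurable]
    simpa only [expNegAbsDeriv_sq] using hsq
  refine ⟨⟨hv.isL2Loc.locallyIntegrable, fun x y => ?_⟩,
    (memLp_two_iff_integrable_sq hc.aestronglyMeasurable).mpr hsq, hv,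
    fun t => (Real.exp_pos _).le, ?_⟩
  · refine integral_eq_of_hasDerivAt_off_countable (fun t => Real.exp (-|t|)) expNegAbsDeriv
      (countable_singleton (0 : ℝ)) hc.continuousOn (fun t ht => ?_)
      (hv.isL2Loc.locallyIntegrable.intervalIntegrable_real x y)
    have ht0 : t ≠ 0 := ht.2
    unfold expNegAbsDeriv
    rcases lt_or_gt_of_ne ht0 with h | h
    · rw [if_pos h]
      simpa using (hasDerivAt_abs_neg h).neg.exp
    · rw [if_neg (not_lt.mpr h.le)]
      simpa using (hasDerivAt_abs_pos h).neg.exp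
  · have h1 : Tendsto (fun t : ℝ => |t|) (cocompact ℝ) atTop :=
      tendsto_norm_cocompact_atTop (E := ℝ)
    exact Real.tendsto_exp_neg_atTop_nhds_zero.comp h1

end CohesiveFracture

/-! ### Bounds for the profile energy -/

namespace CohesiveFracture

variable {f α α' β β' u v p : ℝ → ℝ} {s ℓ ℓ₁ : ℝ}

theorem ofReal_mul_extendTop_sq_mul {b : ℝ} (hb : b < 1) (hf : 0 ≤ f b) (s a : ℝ) :
    ENNReal.ofReal (s ^ 2) * extendTop f b ^ 2 * ENNReal.ofReal (|a| ^ 2)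
      = ENNReal.ofReal (s ^ 2 * f b ^ 2 * a ^ 2) := by
  rw [extendTop, if_pos hb, ← ENNReal.ofReal_pow hf, ← ENNReal.ofReal_mul (sq_nonneg _),
    ← ENNReal.ofReal_mul (by positivity), sq_abs]

/-- Integrable functions below the energy density integrate to a lower bound of the energy. Where
`β = 1` the density is infinite unless `α'` vanishes. -/
theorem integral_le_toReal_profileEnergy (hs : 0 < s) (hE : profileEnergy f s α' β β' ≠ ⊤)
    (hβ : ∀ t, β t ≤ 1) (hf : ∀ t, β t < 1 → 0 ≤ f (β t)) {h : ℝ → ℝ} (hh : Integrable h)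
    (hlt : ∀ t, β t < 1 → h t ≤ s ^ 2 * f (β t) ^ 2 * α' t ^ 2 + (1 - β t) ^ 2 / 4 + β' t ^ 2)
    (heq : ∀ t, β t = 1 → α' t = 0 → h t ≤ β' t ^ 2) :
    ∫ t, h t ≤ (profileEnergy f s α' β β').toReal := by
  have key : ∫⁻ t, ENNReal.ofReal (h t) ≤ profileEnergy f s α' β β' := by
    refine lintegral_mono fun t => ?_
    simp only
    rcases (hβ t).lt_or_eq with ht | ht
    · rw [ofReal_mul_extendTop_sq_mul ht (hf t ht), sq_abs,
        ← ENNReal.ofReal_add (by positivity) (by positivity),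
        ← ENNReal.ofReal_add (by positivity) (by positivity)]
      exact ENNReal.ofReal_le_ofReal (hlt t ht)
    · by_cases ha : α' t = 0
      · rw [sq_abs (β' t)]
        exact (ENNReal.ofReal_le_ofReal (heq t ht ha)).trans le_add_self
      · have h1 : ENNReal.ofReal (s ^ 2) ≠ 0 := by simp; positivity
        have h2 : ENNReal.ofReal (|α' t| ^ 2) ≠ 0 := by simp; positivity
        have : ENNReal.ofReal (s ^ 2) * extendTop f (β t) ^ 2 * ENNReal.ofReal (|α' t| ^ 2) = ⊤ := by
          rw [extendTop, if_neg (not_lt.mpr ht.ge), ENNReal.top_pow (by norm_num),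
            ENNReal.mul_top h1, ENNReal.top_mul h2]
        rw [this]
        simp
  calc ∫ t, h t ≤ ∫ t, max (h t) 0 := integral_mono hh hh.pos_part fun t => le_max_left _ _
    _ = (∫⁻ t, ENNReal.ofReal (h t)).toReal := by
        have h0 : 0 ≤ᵐ[volume] fun t => max (h t) 0 := Eventually.of_forall fun t => le_max_right _ _
        rw [integral_eq_lintegral_of_nonneg_ae h0 hh.pos_part.aestronglyMeasurable]
        congr 1
        refine lintegral_congr fun t => ?_
        rcases le_total (h t) 0 with h0 | h0
        · rw [max_eq_right h0, ENNReal.ofReal_of_nonpos h0, ENNReal.ofReal_zero]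
        · rw [max_eq_left h0]
    _ ≤ _ := ENNReal.toReal_mono hE key

theorem infEnergy_le (h : Admissible α α' β β') : infEnergy f s ≤ profileEnergy f s α' β β' :=
  iInf_le_of_le α <| iInf_le_of_le α' <| iInf_le_of_le β <| iInf_le_of_le β' <| iInf_le _ h

theorem le_infEnergy {x : ℝ≥0∞}
    (h : ∀ α α' β β', Admissible α α' β β' → x ≤ profileEnergy f s α' β β') : x ≤ infEnergy f s :=
  le_iInf fun α => le_iInf fun α' => le_iInf fun β => le_iInf fun β' => le_iInf fun hA =>
    h α α' β β' hA

theorem g₀_le_toReal (h : Admissible α α' β β') (hE : profileEnergy f s α' β β' ≠ ⊤) :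
    g₀ f s ≤ (profileEnergy f s α' β β').toReal :=
  ENNReal.toReal_mono hE (infEnergy_le h)

theorem le_g₀ (htop : infEnergy f s ≠ ⊤) {x : ℝ}
    (h : ∀ α α' β β', Admissible α α' β β' → profileEnergy f s α' β β' ≠ ⊤ →
      x ≤ (profileEnergy f s α' β β').toReal) : x ≤ g₀ f s := by
  rw [g₀, ← ENNReal.ofReal_le_iff_le_toReal htop]
  refine le_infEnergy fun α α' β β' hA => ?_
  by_cases hE : profileEnergy f s α' β β' = ⊤
  · simp [hE]
  · exact (ENNReal.ofReal_le_iff_le_toReal hE).mpr (h α α' β β' hA hE)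

theorem exists_lt_of_g₀_lt (htop : infEnergy f s ≠ ⊤) {x : ℝ} (h : g₀ f s < x) :
    ∃ α α' β β', Admissible α α' β β' ∧ profileEnergy f s α' β β' ≠ ⊤ ∧
      (profileEnergy f s α' β β').toReal < x := by
  by_contra! hcon
  exact absurd (le_g₀ htop hcon) (not_le.mpr h)

/-- Upper bounds for `g₀`: a profile `u ≤ 1` and a density `p` of total mass one are combined into
the admissible pair `β = 1 - u`, `α' = p`. -/
theorem infEnergy_le_of_isProfile (hf : ∀ x ∈ Ico (0 : ℝ) 1, 0 ≤ f x) (hu : IsProfile u v)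
    (hu1 : ∀ t, u t ≤ 1)
    (hpl : IsL2Loc p) (hpi : Integrable p) (hp1 : ∫ t, p t = 1) {H : ℝ → ℝ} (hH : Integrable H)
    (hH0 : ∀ t, 0 ≤ H t) (hpos : ∀ t, 0 < u t → s ^ 2 * f (1 - u t) ^ 2 * p t ^ 2 ≤ H t)
    (hzero : ∀ t, u t = 0 → p t = 0) :
    infEnergy f s ≤
      ENNReal.ofReal ((∫ t, H t) + (∫ t, u t ^ 2) / 4 + ∫ t, v t ^ 2) := by
  have hA : Admissible (fun x => ∫ t in (0 : ℝ)..x, p t) p (fun t => 1 - u t) (fun t => - v t) := by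
    refine ⟨isH1LocWithDeriv_iff.mpr ⟨hpl.isPrimitive, hpl⟩,
      isH1LocWithDeriv_iff.mpr ⟨hu.isPrimitive.const_sub 1, hu.memLp_deriv.isL2Loc.neg⟩, hpi,
      by simp [hp1], fun t => ⟨by linarith [hu1 t], by linarith [hu.nonneg t]⟩, ?_⟩
    simpa using hu.tendsto_zero.const_sub 1
  refine (infEnergy_le hA).trans ?_
  have hi2 : Integrable fun t => u t ^ 2 / 4 := hu.integrable_sq.div_const 4
  have hint : Integrable fun t => H t + u t ^ 2 / 4 + v t ^ 2 :=
    (hH.add hi2).add hu.integrable_deriv_sq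
  have e : (∫ t, H t) + (∫ t, u t ^ 2) / 4 + ∫ t, v t ^ 2
      = ∫ t, (H t + u t ^ 2 / 4 + v t ^ 2) := by
    have h1 : Integrable fun t => H t + u t ^ 2 / 4 := hH.add hi2
    rw [integral_add h1 hu.integrable_deriv_sq, integral_add hH hi2, integral_div]
  rw [e, ofReal_integral_eq_lintegral_ofReal hint (Eventually.of_forall fun t => by
    have := hH0 t
    positivity)]
  refine lintegral_mono fun t => ?_
  simp only
  rw [ENNReal.ofReal_add (by have := hH0 t; positivity) (by positivity),
    ENNReal.ofReal_add (hH0 t) (by positivity), sub_sub_cancel, abs_neg, sq_abs (v t)]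
  gcongr
  rcases (hu.nonneg t).lt_or_eq with h0 | h0
  · rw [ofReal_mul_extendTop_sq_mul (by linarith) (hf _ ⟨by linarith [hu1 t], by linarith⟩)]
    exact ENNReal.ofReal_le_ofReal (hpos t h0)
  · simp [hzero t h0.symm]

theorem IsDegradation.f₁_nonneg (hf : IsDegradation f ℓ ℓ₁) {x : ℝ} (hx : x ∈ Ioc (0 : ℝ) 1) :
    0 ≤ f₁ f x :=
  mul_nonneg hx.1.le (hf.nonneg _ ⟨by linarith [hx.2], by linarith [hx.1]⟩)

namespace Admissible

theorem isProfile (h : Admissible α α' β β') (hE : profileEnergy f s α' β β' ≠ ⊤) :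
    IsProfile (fun t => 1 - β t) (fun t => - β' t) := by
  obtain ⟨hβ, hβ'⟩ := isH1LocWithDeriv_iff.mp h.h1loc_snd
  have hm : AEStronglyMeasurable (fun t => 1 - β t) volume :=
    (continuous_const.sub hβ.continuous).aestronglyMeasurable
  have hm' : AEStronglyMeasurable β' volume := hβ'.locallyIntegrable.aestronglyMeasurable
  have aux : ∀ w : ℝ → ℝ, AEStronglyMeasurable w volume → (∀ t, 0 ≤ w t) →
      ∫⁻ t, ENNReal.ofReal (w t) ≤ profileEnergy f s α' β β' → Integrable w := by
    intro w hw hw0 hle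
    refine ⟨hw, ?_⟩
    rw [hasFiniteIntegral_iff_ofReal (Eventually.of_forall hw0)]
    exact lt_of_le_of_lt hle hE.lt_top
  refine ⟨hβ.const_sub 1, ?_, ?_, fun t => by linarith [(h.mem_Icc t).2], ?_⟩
  · rw [memLp_two_iff_integrable_sq hm]
    have := (aux (fun t => (1 - β t) ^ 2 / 4) ((hm.pow 2).div₀ aestronglyMeasurable_const)
      (fun t => by positivity) (lintegral_mono fun t => le_add_right le_add_self)).mul_const 4
    simpa using this
  · refine MemLp.neg ?_
    rw [memLp_two_iff_integrable_sq hm']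
    refine aux (fun t => β' t ^ 2) (hm'.pow 2) (fun t => by positivity) (lintegral_mono fun t => ?_)
    simp only [sq_abs]
    exact le_add_self
  · simpa using h.tendsto_one.const_sub 1

theorem nonneg_comp (hf : ∀ x ∈ Ico (0 : ℝ) 1, 0 ≤ f x) (h : Admissible α α' β β') (t : ℝ)
    (ht : β t < 1) : 0 ≤ f (β t) :=
  hf _ ⟨(h.mem_Icc t).1, ht⟩

theorem one_le_integral_abs (h : Admissible α α' β β') : 1 ≤ ∫ t, |α' t| := by
  rw [← h.abs_integral_deriv]
  exact abs_integral_le_integral_abs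

/-- The part of the energy that only involves the phase field. -/
theorem phase_le (hf : ∀ x ∈ Ico (0 : ℝ) 1, 0 ≤ f x) (hs : 0 < s) (h : Admissible α α' β β')
    (hE : profileEnergy f s α' β β' ≠ ⊤) :
    (∫ t, (1 - β t) ^ 2) / 4 + ∫ t, (- β' t) ^ 2 ≤ (profileEnergy f s α' β β').toReal := by
  have hP := h.isProfile hE
  have h1 : Integrable fun t => (1 - β t) ^ 2 / 4 := hP.integrable_sq.div_const 4
  rw [← integral_div, ← integral_add h1 hP.integrable_deriv_sq]
  refine integral_le_toReal_profileEnergy hs hE (fun t => (h.mem_Icc t).2) (h.nonneg_comp hf)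
    (h1.add hP.integrable_deriv_sq) (fun t _ => ?_) fun t ht _ => ?_
  · have : 0 ≤ s ^ 2 * f (β t) ^ 2 * α' t ^ 2 := by positivity
    rw [neg_sq]
    linarith
  · rw [ht]
    simp

/-- If the phase field stays above `1 - r`, then the elastic energy costs at least `s f₁(r)`. -/
theorem mul_f₁_le (hf : IsDegradation f ℓ ℓ₁) (hs : 0 < s) (h : Admissible α α' β β')
    (hE : profileEnergy f s α' β β' ≠ ⊤) {r : ℝ} (hr : r ∈ Ioc (0 : ℝ) 1)
    (hβ : ∀ t, 1 - β t ≤ r) : s * f₁ f r ≤ (profileEnergy f s α' β β').toReal := by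
  have hr0 := hf.f₁_nonneg hr
  calc s * f₁ f r ≤ s * f₁ f r * ∫ t, |α' t| :=
        le_mul_of_one_le_right (mul_nonneg hs.le hr0) h.one_le_integral_abs
    _ = ∫ t, s * f₁ f r * |α' t| := (integral_const_mul _ _).symm
    _ ≤ _ := by
      refine integral_le_toReal_profileEnergy hs hE (fun t => (h.mem_Icc t).2)
        (h.nonneg_comp hf.nonneg) (h.integrable_deriv.abs.const_mul _) (fun t ht => ?_)
        fun t _ ha => ?_
      · have hmono : f₁ f r ≤ (1 - β t) * f (β t) := by
          have := hf.strictAntiOn.antitoneOn (a := 1 - β t) (b := r)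
            ⟨by linarith, by linarith [(h.mem_Icc t).1]⟩ hr (hβ t)
          simpa [f₁] using this
        have h1 : s * f₁ f r * |α' t| ≤ s * ((1 - β t) * f (β t)) * |α' t| := by gcongr
        -- Young's inequality `a² + b² ≥ 2 a b` with `a = s f(β) |α'|` and `b = (1 - β) / 2`
        have h2 := sq_nonneg (s * f (β t) * |α' t| - (1 - β t) / 2)
        have h3 : (s * f (β t) * |α' t|) ^ 2 = s ^ 2 * f (β t) ^ 2 * α' t ^ 2 := by
          rw [mul_pow, mul_pow, sq_abs]
        nlinarith [sq_nonneg (β' t)]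
      · rw [ha]
        simpa using sq_nonneg _

/-- A linearised lower bound for the energy of profiles of small height: the elastic term is
bounded from below by `2 μ s ℓ |α'| - μ² ℓ² / f²(β)`, which is optimal near `μ = 1 / 2`. -/
theorem linearised_le (hf : IsDegradation f ℓ ℓ₁) (hs : 0 < s) (h : Admissible α α' β β')
    (hE : profileEnergy f s α' β β' ≠ ⊤) {m c μ : ℝ} (hm : ∀ t, 1 - β t ≤ m) (hm1 : m < 1)
    (hμ : 0 ≤ μ)
    (hc : ∀ x ∈ Ioc 0 m, ℓ ^ 2 ≤ f₁ f x ^ 2 * (1 + c * x)) :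
    2 * μ * s * ℓ - μ ^ 2 * ((∫ t, (1 - β t) ^ 2) + c * ∫ t, (1 - β t) ^ 3)
      + ((∫ t, (1 - β t) ^ 2) / 4 + ∫ t, (- β' t) ^ 2) ≤ (profileEnergy f s α' β β').toReal := by
  have hP := h.isProfile hE
  have i1 : Integrable fun t => 2 * μ * s * ℓ * |α' t| := h.integrable_deriv.abs.const_mul _
  have i2 : Integrable fun t => (1 - β t) ^ 2 + c * (1 - β t) ^ 3 :=
    hP.integrable_sq.add (hP.integrable_cube.const_mul c)
  have i3 : Integrable fun t => μ ^ 2 * ((1 - β t) ^ 2 + c * (1 - β t) ^ 3) := i2.const_mul _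
  have i4 : Integrable fun t => (1 - β t) ^ 2 / 4 := hP.integrable_sq.div_const 4
  have i5 : Integrable fun t => (1 - β t) ^ 2 / 4 + (- β' t) ^ 2 := i4.add hP.integrable_deriv_sq
  have i6 : Integrable fun t => 2 * μ * s * ℓ * |α' t|
    - μ ^ 2 * ((1 - β t) ^ 2 + c * (1 - β t) ^ 3) := i1.sub i3
  have i7 : Integrable fun t => 2 * μ * s * ℓ * |α' t|
      - μ ^ 2 * ((1 - β t) ^ 2 + c * (1 - β t) ^ 3)
      + ((1 - β t) ^ 2 / 4 + (- β' t) ^ 2) := i6.add i5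
  have e : ∫ t, (2 * μ * s * ℓ * |α' t| - μ ^ 2 * ((1 - β t) ^ 2 + c * (1 - β t) ^ 3)
        + ((1 - β t) ^ 2 / 4 + (- β' t) ^ 2))
      = 2 * μ * s * ℓ * (∫ t, |α' t|)
        - μ ^ 2 * ((∫ t, (1 - β t) ^ 2) + c * ∫ t, (1 - β t) ^ 3)
        + ((∫ t, (1 - β t) ^ 2) / 4 + ∫ t, (- β' t) ^ 2) := by
    rw [integral_add i6 i5, integral_sub i1 i3, integral_add i4 hP.integrable_deriv_sq,
      integral_const_mul, integral_const_mul,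
      integral_add hP.integrable_sq (hP.integrable_cube.const_mul c), integral_const_mul,
      integral_div]
  have hℓ := hf.slope_pos
  have h1 : 2 * μ * s * ℓ ≤ 2 * μ * s * ℓ * ∫ t, |α' t| :=
    le_mul_of_one_le_right (by positivity) h.one_le_integral_abs
  refine le_trans ?_ (integral_le_toReal_profileEnergy hs hE (fun t => (h.mem_Icc t).2)
    (h.nonneg_comp hf.nonneg) i7 (fun t ht => ?_) fun t ht ha => ?_)
  · refine le_trans ?_ e.symm.le
    linarith
  · have hx0 : 0 < 1 - β t := by linarith
    have hb0 : 0 < β t := by linarith [hm t]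
    have hfb : 0 < f (β t) := by
      refine lt_of_le_of_ne (h.nonneg_comp hf.nonneg t ht) fun h0 => ?_
      exact hb0.ne' ((hf.zero_iff _ ⟨hb0.le, ht⟩).mp h0.symm)
    have hcx := hc (1 - β t) ⟨hx0, hm t⟩
    rw [f₁, sub_sub_cancel] at hcx
    -- with `w = ℓ / f(β)`, the hypothesis on `c` reads `w² ≤ u² + c u³`
    have hw : (ℓ / f (β t)) ^ 2 ≤ (1 - β t) ^ 2 + c * (1 - β t) ^ 3 := by
      rw [div_pow, div_le_iff₀ (by positivity)]
      nlinarith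
    have hA : 2 * μ * s * ℓ * |α' t|
        ≤ s ^ 2 * f (β t) ^ 2 * α' t ^ 2 + μ ^ 2 * (ℓ / f (β t)) ^ 2 := by
      have := sq_nonneg (s * f (β t) * |α' t| - μ * (ℓ / f (β t)))
      have e1 : s * f (β t) * |α' t| * (μ * (ℓ / f (β t))) = μ * s * ℓ * |α' t| := by
        field_simp
      have e2 : (s * f (β t) * |α' t|) ^ 2 = s ^ 2 * f (β t) ^ 2 * α' t ^ 2 := by
        rw [mul_pow, mul_pow, sq_abs]
      nlinarith
    have hB := mul_le_mul_of_nonneg_left hw (sq_nonneg μ)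
    rw [neg_sq]
    linarith
  · simp [ht, ha]

end Admissible

end CohesiveFracture

/-! ### Rescaling of the energy, and the cubic variational constant -/

namespace CohesiveFracture

section Rescaling

variable {f α α' β β' : ℝ → ℝ} {s c : ℝ}

theorem Admissible.rescale (h : Admissible α α' β β') (hc : 0 < c) :
    Admissible (fun t => α (c * t)) (fun t => c * α' (c * t))
      (fun t => β (c * t)) (fun t => c * β' (c * t)) := by
  obtain ⟨hα, hα'⟩ := isH1LocWithDeriv_iff.mp h.h1loc_fst
  obtain ⟨hβ, hβ'⟩ := isH1LocWithDeriv_iff.mp h.h1loc_snd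
  refine ⟨isH1LocWithDeriv_iff.mpr
      ⟨hα.comp_mul_left hα' hc.ne', (hα'.comp_mul_left hc.ne').const_mul c⟩,
    isH1LocWithDeriv_iff.mpr
      ⟨hβ.comp_mul_left hβ' hc.ne', (hβ'.comp_mul_left hc.ne').const_mul c⟩,
    (h.integrable_deriv.comp_mul_left' hc.ne').const_mul c, ?_, fun t => h.mem_Icc _,
    h.tendsto_one.comp (tendsto_cocompact_mul_left₀ hc.ne')⟩
  rw [integral_const_mul, Measure.integral_comp_mul_left α' c, abs_of_pos (inv_pos.mpr hc),
    smul_eq_mul, mul_inv_cancel_left₀ hc.ne', h.abs_integral_deriv]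

theorem lintegral_comp_mul_left (F : ℝ → ℝ≥0∞) (hc : 0 < c) :
    ∫⁻ t, F (c * t) = ENNReal.ofReal c⁻¹ * ∫⁻ t, F t := by
  let e : ℝ ≃ᵐ ℝ := (Homeomorph.mulLeft₀ c hc.ne').toMeasurableEquiv
  have he : (e : ℝ → ℝ) = fun t => c * t := rfl
  have := lintegral_map_equiv (μ := volume) F e
  rw [he, Real.map_volume_mul_left hc.ne', lintegral_smul_measure,
    abs_of_pos (inv_pos.mpr hc)] at this
  exact this.symm

/-- Stretching an admissible pair by the factor `1 / c` and multiplying the opening by the same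
factor multiplies the energy by `1 / c`, except for the gradient term, which is multiplied
by `c`. -/
theorem profileEnergy_rescale (h : Admissible α α' β β') (hE : profileEnergy f s α' β β' ≠ ⊤)
    (hc : 0 < c) :
    profileEnergy f (s / c) (fun t => c * α' (c * t)) (fun t => β (c * t))
        (fun t => c * β' (c * t)) ≠ ⊤ ∧
      (profileEnergy f (s / c) (fun t => c * α' (c * t)) (fun t => β (c * t))
        (fun t => c * β' (c * t))).toReal
      = c⁻¹ * ((profileEnergy f s α' β β').toReal - (1 - c ^ 2) * ∫ t, (- β' t) ^ 2) := by
  have hK := (h.isProfile hE).integrable_deriv_sq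
  set A : ℝ≥0∞ := ∫⁻ t,
    (ENNReal.ofReal (s ^ 2) * extendTop f (β t) ^ 2 * ENNReal.ofReal (|α' t| ^ 2)
      + ENNReal.ofReal ((1 - β t) ^ 2 / 4)) with hA
  set B : ℝ≥0∞ := ∫⁻ t, ENNReal.ofReal (|β' t| ^ 2) with hB
  have hBK : B = ENNReal.ofReal (∫ t, (- β' t) ^ 2) := by
    rw [ofReal_integral_eq_lintegral_ofReal hK (Eventually.of_forall fun t => sq_nonneg _)]
    simp [hB]
  have hmeas : AEMeasurable (fun t => ENNReal.ofReal (|β' t| ^ 2)) volume := by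
    have := hK.aestronglyMeasurable.aemeasurable.ennreal_ofReal
    simpa using this
  have hsplit : profileEnergy f s α' β β' = A + B := by
    rw [profileEnergy, lintegral_add_right' _ hmeas]
  have hAtop : A ≠ ⊤ := fun hcon => hE (by rw [hsplit, hcon, top_add])
  have hresc : profileEnergy f (s / c) (fun t => c * α' (c * t)) (fun t => β (c * t))
      (fun t => c * β' (c * t)) = ENNReal.ofReal c⁻¹ * (A + ENNReal.ofReal (c ^ 2) * B) := by
    rw [hA, hB, ← lintegral_const_mul' _ _ ENNReal.ofReal_ne_top,
      ← lintegral_add_right' _ (hmeas.const_mul _), ← lintegral_comp_mul_left _ hc]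
    refine lintegral_congr fun t => ?_
    congr 2
    · have e : ENNReal.ofReal (s ^ 2)
          = ENNReal.ofReal ((s / c) ^ 2) * ENNReal.ofReal (|c| ^ 2) := by
        rw [← ENNReal.ofReal_mul (sq_nonneg _), sq_abs, div_pow, div_mul_cancel₀]
        positivity
      rw [abs_mul, mul_pow, ENNReal.ofReal_mul (sq_nonneg _), e]
      ring
    · rw [abs_mul, mul_pow, ENNReal.ofReal_mul (sq_nonneg _), sq_abs]
  have hK0 : 0 ≤ ∫ t, (- β' t) ^ 2 := integral_nonneg fun t => sq_nonneg _
  have hBtop : B ≠ ⊤ := by rw [hBK]; exact ENNReal.ofReal_ne_top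
  have hcB : ENNReal.ofReal (c ^ 2) * B ≠ ⊤ := ENNReal.mul_ne_top ENNReal.ofReal_ne_top hBtop
  refine ⟨?_, ?_⟩
  · rw [hresc]
    exact ENNReal.mul_ne_top ENNReal.ofReal_ne_top (ENNReal.add_ne_top.mpr ⟨hAtop, hcB⟩)
  · rw [hresc, hsplit, ENNReal.toReal_mul, ENNReal.toReal_add hAtop hcB,
      ENNReal.toReal_add hAtop hBtop, ENNReal.toReal_mul, hBK, ENNReal.toReal_ofReal hK0,
      ENNReal.toReal_ofReal (inv_nonneg.mpr hc.le), ENNReal.toReal_ofReal (sq_nonneg c)]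
    ring

theorem infEnergy_mono (f : ℝ → ℝ) {s₁ s₂ : ℝ} (h1 : 0 ≤ s₁) (h2 : s₁ ≤ s₂) :
    infEnergy f s₁ ≤ infEnergy f s₂ := by
  refine le_infEnergy fun α α' β β' hA => (infEnergy_le hA).trans (lintegral_mono fun t => ?_)
  simp only
  gcongr

end Rescaling

section Cubic

/-- The set of quotients `(κ ∫ u³ - ∫ u'²) / (∫ u²)^{5/3}` over all nontrivial profiles. The
quotient is invariant under `u ↦ σ² u(σ ·)`. -/
def cubicQuotients (κ : ℝ) : Set ℝ :=
  {x | ∃ u v, IsProfile u v ∧ 0 < ∫ t, u t ^ 2 ∧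
    x = (κ * (∫ t, u t ^ 3) - ∫ t, v t ^ 2) / (∫ t, u t ^ 2) ^ (5 / 3 : ℝ)}

/-- The best constant in `κ ∫ u³ ≤ ∫ u'² + C (∫ u²)^{5/3}` for profiles `u`. -/
noncomputable def cubicConst (κ : ℝ) : ℝ := sSup (cubicQuotients κ)

variable {u v : ℝ → ℝ} {κ : ℝ}

/-- Absorb the Gagliardo–Nirenberg bound `∫ u³ ≤ (∫ u²)^{5/4} (∫ u'²)^{1/4}` into the gradient
term. -/
theorem IsProfile.mul_integral_cube_sub_le (h : IsProfile u v) (κ : ℝ) :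
    κ * (∫ t, u t ^ 3) - ∫ t, v t ^ 2
      ≤ |κ| * (|κ| + 1) * (∫ t, u t ^ 2) ^ (5 / 3 : ℝ) := by
  have hI := h.integral_cube_nonneg
  have hGN := h.integral_cube_pow_four_le
  have hK : 0 ≤ ∫ t, v t ^ 2 := integral_nonneg fun t => sq_nonneg _
  have hD : 0 ≤ ∫ t, u t ^ 2 := integral_nonneg fun t => sq_nonneg _
  set D := ∫ t, u t ^ 2
  set K := ∫ t, v t ^ 2
  set I := ∫ t, u t ^ 3
  set a := |κ|
  have ha : 0 ≤ a := abs_nonneg κ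
  -- in terms of `d` and `k` the claim is the polynomial inequality
  -- `a d³ k - k⁴ ≤ a (a + 1) d⁴`, checked separately for `k ≤ (a + 1) d` and `k ≥ (a + 1) d`
  set d := D ^ (5 / 12 : ℝ)
  set k := K ^ (1 / 4 : ℝ)
  have hd : 0 ≤ d := Real.rpow_nonneg hD _
  have hk : 0 ≤ k := Real.rpow_nonneg hK _
  have hd12 : d ^ 12 = D ^ 5 := by
    rw [← Real.rpow_natCast, ← Real.rpow_mul hD, ← Real.rpow_natCast]
    norm_num
  have hk4 : k ^ 4 = K := by
    rw [← Real.rpow_natCast, ← Real.rpow_mul hK]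
    norm_num
  have hd4 : d ^ 4 = D ^ (5 / 3 : ℝ) := by
    rw [← Real.rpow_natCast, ← Real.rpow_mul hD]
    norm_num
  have hIdk : I ≤ d ^ 3 * k := by
    refine le_of_pow_le_pow_left₀ (n := 4) (by norm_num) (by positivity) ?_
    calc I ^ 4 ≤ D ^ 5 * K := hGN
      _ = (d ^ 3 * k) ^ 4 := by rw [← hd12, ← hk4]; ring
  have h1 : κ * I ≤ a * (d ^ 3 * k) :=
    (mul_le_mul_of_nonneg_right (le_abs_self κ) hI).trans (mul_le_mul_of_nonneg_left hIdk ha)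
  rw [← hd4, ← hk4]
  rcases le_total k ((a + 1) * d) with hkd | hkd
  · have : a * (d ^ 3 * k) ≤ a * (d ^ 3 * ((a + 1) * d)) := by gcongr
    nlinarith [pow_nonneg hk 4]
  · have h2 : (a + 1) * d ^ 3 ≤ k ^ 3 := by
      have h3 : ((a + 1) * d) ^ 3 ≤ k ^ 3 := pow_le_pow_left₀ (by positivity) hkd 3
      have h4 : (a + 1) * d ^ 3 ≤ ((a + 1) * d) ^ 3 := by
        rw [mul_pow]
        exact mul_le_mul_of_nonneg_right (le_self_pow₀ (by linarith) (by norm_num)) (by positivity)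
      linarith
    have h5 : a * (d ^ 3 * k) ≤ k ^ 4 := by
      nlinarith [mul_le_mul_of_nonneg_right h2 hk, mul_nonneg (pow_nonneg hd 3) hk]
    have : 0 ≤ a * (a + 1) * d ^ 4 := by positivity
    linarith

theorem bddAbove_cubicQuotients (κ : ℝ) : BddAbove (cubicQuotients κ) := by
  refine ⟨|κ| * (|κ| + 1), ?_⟩
  rintro x ⟨u, v, h, hD, rfl⟩
  rw [div_le_iff₀ (Real.rpow_pos_of_pos hD _)]
  exact h.mul_integral_cube_sub_le κ

theorem IsProfile.div_mem_cubicQuotients (h : IsProfile u v) (hD : 0 < ∫ t, u t ^ 2) (κ : ℝ) :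
    (κ * (∫ t, u t ^ 3) - ∫ t, v t ^ 2) / (∫ t, u t ^ 2) ^ (5 / 3 : ℝ) ∈ cubicQuotients κ :=
  ⟨u, v, h, hD, rfl⟩

theorem cubicQuotients_nonempty (κ : ℝ) : (cubicQuotients κ).Nonempty :=
  ⟨_, isProfile_exp_neg_abs.div_mem_cubicQuotients (by rw [integral_exp_neg_abs_sq]; norm_num) κ⟩

theorem IsProfile.mul_integral_cube_le (h : IsProfile u v) (κ : ℝ) :
    κ * (∫ t, u t ^ 3) - ∫ t, v t ^ 2 ≤ cubicConst κ * (∫ t, u t ^ 2) ^ (5 / 3 : ℝ) := by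
  have hD0 : 0 ≤ ∫ t, u t ^ 2 := integral_nonneg fun t => sq_nonneg _
  rcases hD0.lt_or_eq with hD | hD
  · rw [← div_le_iff₀ (Real.rpow_pos_of_pos hD _)]
    exact le_csSup (bddAbove_cubicQuotients κ) (h.div_mem_cubicQuotients hD κ)
  · have := h.mul_integral_cube_sub_le κ
    rw [← hD, Real.zero_rpow (by norm_num), mul_zero] at this ⊢
    exact this

theorem exists_isProfile_lt {x : ℝ} (hx : x < cubicConst κ) :
    ∃ u v, IsProfile u v ∧ 0 < ∫ t, u t ^ 2 ∧
      x < (κ * (∫ t, u t ^ 3) - ∫ t, v t ^ 2) / (∫ t, u t ^ 2) ^ (5 / 3 : ℝ) := by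
  obtain ⟨_, ⟨u, v, h, hD, rfl⟩, hlt⟩ := exists_lt_of_lt_csSup (cubicQuotients_nonempty κ) hx
  exact ⟨u, v, h, hD, hlt⟩

/-- As a supremum of affine functions, `cubicConst` is convex, hence continuous. -/
theorem continuous_cubicConst : Continuous cubicConst := by
  have hconv : ConvexOn ℝ univ cubicConst := by
    refine ⟨convex_univ, fun κ₁ _ κ₂ _ a b ha hb hab => ?_⟩
    refine csSup_le (cubicQuotients_nonempty _) ?_
    rintro x ⟨u, v, h, hD, rfl⟩
    have h1 := le_csSup (bddAbove_cubicQuotients κ₁) (h.div_mem_cubicQuotients hD κ₁)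
    have h2 := le_csSup (bddAbove_cubicQuotients κ₂) (h.div_mem_cubicQuotients hD κ₂)
    have h3 := add_le_add (mul_le_mul_of_nonneg_left h1 ha) (mul_le_mul_of_nonneg_left h2 hb)
    refine le_trans (le_of_eq ?_) h3
    simp only [smul_eq_mul]
    have : b = 1 - a := by linarith
    rw [this]
    ring
  exact continuousOn_univ.mp (hconv.continuousOn isOpen_univ)

/-- Wide profiles make the cubic term dominate the gradient term. -/
theorem cubicConst_pos (hκ : 0 < κ) : 0 < cubicConst κ := by
  set I := ∫ t : ℝ, Real.exp (-|t|) ^ 3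
  have hI : 0 < I := by
    rw [integral_pos_iff_support_of_nonneg (fun t => by positivity)
      isProfile_exp_neg_abs.integrable_cube]
    have : Function.support (fun t : ℝ => Real.exp (-|t|) ^ 3) = univ :=
      Function.support_eq_univ fun t => by positivity
    simp [this]
  set c := min 1 (κ * I / 2)
  have hc : 0 < c := lt_min one_pos (by positivity)
  have hP := isProfile_exp_neg_abs.rescale zero_le_one hc
  have eD : ∫ t : ℝ, (1 * Real.exp (-|c * t|)) ^ 2 = c⁻¹ := by
    rw [IsProfile.integral_rescale_pow (u := fun t => Real.exp (-|t|)) 1 hc 2,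
      integral_exp_neg_abs_sq]
    simp
  have eI : ∫ t : ℝ, (1 * Real.exp (-|c * t|)) ^ 3 = I / c := by
    rw [IsProfile.integral_rescale_pow (u := fun t => Real.exp (-|t|)) 1 hc 3]
    ring
  have eK : ∫ t : ℝ, (1 * (c * expNegAbsDeriv (c * t))) ^ 2 = c := by
    have : ∀ t, (1 * (c * expNegAbsDeriv (c * t))) ^ 2 = (c * expNegAbsDeriv (c * t)) ^ 2 :=
      fun t => by ring
    simp_rw [this]
    rw [IsProfile.integral_rescale_pow (u := expNegAbsDeriv) c hc 2]
    simp_rw [expNegAbsDeriv_sq]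
    rw [integral_exp_neg_abs_sq]
    field_simp
  have key := hP.div_mem_cubicQuotients (by rw [eD]; positivity) κ
  rw [eD, eI, eK] at key
  refine lt_of_lt_of_le ?_ (le_csSup (bddAbove_cubicQuotients κ) key)
  refine div_pos ?_ (Real.rpow_pos_of_pos (inv_pos.mpr hc) _)
  have h1 : c ≤ 1 := min_le_left _ _
  have h2 : c ≤ κ * I / 2 := min_le_right _ _
  have h3 : κ * (I / c) = κ * I / c := by ring
  rw [h3, sub_pos, lt_div_iff₀ hc]
  have : 0 < κ * I := by positivity
  nlinarith

end Cubic

end CohesiveFracture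

/-! ### Upper bounds for the cohesive energy -/

namespace CohesiveFracture

variable {f u v : ℝ → ℝ} {ℓ ℓ₁ s : ℝ}

namespace IsDegradation

theorem eventually_abs_f₁_sub_le (hf : IsDegradation f ℓ ℓ₁) {η : ℝ} (hη : 0 < η) :
    ∀ᶠ x in 𝓝[>] (0 : ℝ), |f₁ f x - (ℓ - ℓ₁ * x)| ≤ η * x := by
  filter_upwards [hf.expansion.def hη, self_mem_nhdsWithin] with x hx hx0
  rwa [Real.norm_eq_abs, Real.norm_of_nonneg (le_of_lt hx0)] at hx

theorem tendsto_f₁ (hf : IsDegradation f ℓ ℓ₁) : Tendsto (f₁ f) (𝓝[>] 0) (𝓝 ℓ) := by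
  have hid : Tendsto (fun x : ℝ => x) (𝓝[>] 0) (𝓝 0) :=
    tendsto_nhdsWithin_of_tendsto_nhds tendsto_id
  have h1 := hf.expansion.trans_tendsto hid
  have h2 := h1.add ((tendsto_const_nhds (x := ℓ)).sub (hid.const_mul ℓ₁))
  simpa using h2

theorem f₁_pos (hf : IsDegradation f ℓ ℓ₁) {x : ℝ} (hx : x ∈ Ioo (0 : ℝ) 1) : 0 < f₁ f x :=
  (hf.f₁_nonneg ⟨one_pos, le_rfl⟩).trans_lt
    (hf.strictAntiOn ⟨hx.1, hx.2.le⟩ ⟨one_pos, le_rfl⟩ hx.2)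

/-- Near zero, `ℓ² / f₁(x)² ≤ 1 + c x` for any `c` above `2 ℓ₁ / ℓ`, the derivative of the
left-hand side at zero. -/
theorem exists_sq_le_f₁_sq_mul (hf : IsDegradation f ℓ ℓ₁) {c : ℝ} (hc : 2 * ℓ₁ < c * ℓ) :
    ∃ m ∈ Ioo (0 : ℝ) 1, ∀ x ∈ Ioc 0 m, ℓ ^ 2 ≤ f₁ f x ^ 2 * (1 + c * x) := by
  have hℓ := hf.slope_pos
  have hℓ₁ := hf.slope_deriv_pos
  have hc0 : 0 < c := by
    by_contra! h
    nlinarith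
  set η := (c * ℓ - 2 * ℓ₁) / 4 with hη
  have hη0 : 0 < η := by rw [hη]; linarith
  set a := ℓ₁ + η with ha
  have ha0 : 0 < a := by positivity
  have h1 : ∀ᶠ x in 𝓝[>] (0 : ℝ), 2 * a * c * x < 2 * η := by
    have : Tendsto (fun x : ℝ => 2 * a * c * x) (𝓝[>] 0) (𝓝 (2 * a * c * 0)) :=
      tendsto_nhdsWithin_of_tendsto_nhds (tendsto_id.const_mul _)
    exact this.eventually_lt_const (by simpa using hη0)
  have h2 : ∀ᶠ x in 𝓝[>] (0 : ℝ), a * x < ℓ := by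
    have : Tendsto (fun x : ℝ => a * x) (𝓝[>] 0) (𝓝 (a * 0)) :=
      tendsto_nhdsWithin_of_tendsto_nhds (tendsto_id.const_mul _)
    exact this.eventually_lt_const (by simpa using hℓ)
  have h3 : ∀ᶠ x in 𝓝[>] (0 : ℝ), ℓ ^ 2 ≤ f₁ f x ^ 2 * (1 + c * x) := by
    filter_upwards [h1, h2, hf.eventually_abs_f₁_sub_le hη0, self_mem_nhdsWithin]
      with x hx1 hx2 hx3 hx0
    have hx0 : 0 < x := hx0
    have hlow : ℓ - a * x ≤ f₁ f x := by
      have := (abs_le.mp hx3).1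
      rw [ha]
      linarith
    have hsq : (ℓ - a * x) ^ 2 ≤ f₁ f x ^ 2 := pow_le_pow_left₀ (by linarith) hlow 2
    have e : c * ℓ = 2 * a + 2 * η := by rw [ha, hη]; ring
    calc ℓ ^ 2 ≤ (ℓ ^ 2 - 2 * a * ℓ * x) * (1 + c * x) := by
          have : 0 ≤ ℓ * x * (2 * η - 2 * a * c * x) := by
            have := sub_pos.mpr hx1
            positivity
          nlinarith
      _ ≤ (ℓ - a * x) ^ 2 * (1 + c * x) := by
          gcongr
          nlinarith [sq_nonneg (a * x)]
      _ ≤ f₁ f x ^ 2 * (1 + c * x) := by gcongr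
  obtain ⟨m, hm, hsub⟩ := mem_nhdsGT_iff_exists_Ioc_subset.mp h3
  refine ⟨min m (1 / 2), ⟨lt_min hm (by norm_num), (min_le_right _ _).trans_lt (by norm_num)⟩,
    fun x hx => hsub ⟨hx.1, hx.2.trans (min_le_left _ _)⟩⟩

/-- An upper bound for `f₁` near zero, for any slope `c ℓ / 2` below `ℓ₁`. -/
theorem exists_f₁_le (hf : IsDegradation f ℓ ℓ₁) {c : ℝ} (hc : c * ℓ < 2 * ℓ₁) :
    ∃ m ∈ Ioo (0 : ℝ) 1, ∀ x ∈ Ioc 0 m, f₁ f x ≤ ℓ * (1 - c * x / 2) := by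
  set η := (2 * ℓ₁ - c * ℓ) / 2 with hη
  have hη0 : 0 < η := by rw [hη]; linarith
  have h3 : ∀ᶠ x in 𝓝[>] (0 : ℝ), f₁ f x ≤ ℓ * (1 - c * x / 2) := by
    filter_upwards [hf.eventually_abs_f₁_sub_le hη0] with x hx
    have := (abs_le.mp hx).2
    rw [hη] at this
    linarith
  obtain ⟨m, hm, hsub⟩ := mem_nhdsGT_iff_exists_Ioc_subset.mp h3
  refine ⟨min m (1 / 2), ⟨lt_min hm (by norm_num), (min_le_right _ _).trans_lt (by norm_num)⟩,
    fun x hx => hsub ⟨hx.1, hx.2.trans (min_le_left _ _)⟩⟩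

/-- A `C¹` function vanishing at `0` is bounded by a linear function near `0`. -/
theorem exists_le_mul (hf : IsDegradation f ℓ ℓ₁) :
    ∃ C, 0 ≤ C ∧ ∃ δ > 0, ∀ x ∈ Ico 0 δ, f x ≤ C * x := by
  have h0 : (0 : ℝ) ∈ Ico (0 : ℝ) 1 := ⟨le_rfl, one_pos⟩
  have hf0 : f 0 = 0 := (hf.zero_iff 0 h0).mpr rfl
  obtain ⟨C, hC0, hC⟩ :=
    ((hf.contDiffOn.differentiableOn (by simp)) 0 h0).isBigO_sub.exists_nonneg
  obtain ⟨δ, hδ, hb⟩ := Metric.mem_nhdsWithin_iff.mp hC.bound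
  refine ⟨C, hC0, min δ 1, lt_min hδ one_pos, fun x hx => ?_⟩
  have := hb (a := x) ⟨by
    rw [mem_ball_zero_iff, Real.norm_of_nonneg hx.1]
    exact hx.2.trans_le (min_le_left _ _), hx.1, hx.2.trans_le (min_le_right _ _)⟩
  simp only [mem_ofPred_eq, hf0, sub_zero, Real.norm_of_nonneg hx.1] at this
  exact (le_abs_self _).trans this

end IsDegradation

/-- Test with `u = exp (-|t| / 2)`, whose phase field energy is one, and with an opening that is
concentrated near the point where `β = 0`. -/
theorem infEnergy_le_one (hf : IsDegradation f ℓ ℓ₁) (s : ℝ) : infEnergy f s ≤ 1 := by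
  obtain ⟨C, hC, δ, hδ, hfC⟩ := hf.exists_le_mul
  have hP := isProfile_exp_neg_abs.rescale zero_le_one (c := 1 / 2) (by norm_num)
  have eD : ∫ t : ℝ, (1 * Real.exp (-|1 / 2 * t|)) ^ 2 = 2 := by
    rw [IsProfile.integral_rescale_pow (u := fun t => Real.exp (-|t|)) 1 (by norm_num) 2,
      integral_exp_neg_abs_sq]
    norm_num
  have eK : ∫ t : ℝ, (1 * (1 / 2 * expNegAbsDeriv (1 / 2 * t))) ^ 2 = 1 / 2 := by
    have : ∀ t, (1 * (1 / 2 * expNegAbsDeriv (1 / 2 * t))) ^ 2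
        = (1 / 2 * expNegAbsDeriv (1 / 2 * t)) ^ 2 := fun t => by ring
    simp_rw [this]
    rw [IsProfile.integral_rescale_pow (u := expNegAbsDeriv) (1 / 2) (by norm_num) 2]
    simp_rw [expNegAbsDeriv_sq]
    rw [integral_exp_neg_abs_sq]
    norm_num
  have bound : ∀ ε ∈ Ioo 0 δ, infEnergy f s ≤ ENNReal.ofReal (s ^ 2 * C ^ 2 / 4 * (2 * ε) + 1) := by
    intro ε hε
    have hvol : volume.real (Icc (-ε) ε) = 2 * ε := by
      rw [Real.volume_real_Icc_of_le (by linarith [hε.1])]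
      ring
    have hfin : volume (Icc (-ε) ε) ≠ ⊤ := measure_Icc_lt_top.ne
    have hI : ∀ a : ℝ, ∫ t, (Icc (-ε) ε).indicator (fun _ => a) t = a * (2 * ε) := fun a => by
      rw [integral_indicator_const a measurableSet_Icc, hvol, smul_eq_mul, mul_comm]
    have hInt : ∀ a : ℝ, Integrable ((Icc (-ε) ε).indicator fun _ => a) := fun a =>
      (integrable_indicator_iff measurableSet_Icc).mpr (integrableOn_const hfin)
    have hε0 := hε.1
    refine (infEnergy_le_of_isProfile hf.nonneg hP (fun t => ?_)
      (p := (Icc (-ε) ε).indicator fun _ => 1 / (2 * ε))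
      (H := (Icc (-ε) ε).indicator fun _ => s ^ 2 * C ^ 2 / 4)
      (MemLp.isL2Loc (memLp_indicator_const 2 measurableSet_Icc _ (Or.inr hfin))) (hInt _)
      ?_ (hInt _) (fun t => indicator_nonneg (fun _ _ => by positivity) t) (fun t _ => ?_)
      fun t ht => ?_).trans_eq ?_
    · rw [one_mul, Real.exp_le_one_iff]
      linarith [abs_nonneg (1 / 2 * t)]
    · rw [hI]
      field_simp
    · by_cases ht : t ∈ Icc (-ε) ε
      · rw [indicator_of_mem ht, indicator_of_mem ht]
        have habs : |1 / 2 * t| ≤ ε / 2 := by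
          rw [abs_mul, abs_of_pos (by norm_num : (0 : ℝ) < 1 / 2)]
          linarith [abs_le.mpr ht]
        set x := 1 - 1 * Real.exp (-|1 / 2 * t|) with hx
        have hx0 : 0 ≤ x := by
          rw [hx, one_mul, sub_nonneg, Real.exp_le_one_iff]
          linarith [abs_nonneg (1 / 2 * t)]
        have hxε : x ≤ ε / 2 := by
          have := Real.add_one_le_exp (-|1 / 2 * t|)
          rw [hx]
          linarith
        have hx1 : x < 1 := by
          have := Real.exp_pos (-|1 / 2 * t|)
          rw [hx]
          linarith
        have hfx : f x ≤ C * ε :=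
          (hfC x ⟨hx0, by linarith [hε.2]⟩).trans (mul_le_mul_of_nonneg_left (by linarith) hC)
        have hfx2 : f x ^ 2 ≤ (C * ε) ^ 2 := pow_le_pow_left₀ (hf.nonneg x ⟨hx0, hx1⟩) hfx 2
        calc s ^ 2 * f x ^ 2 * (1 / (2 * ε)) ^ 2 ≤ s ^ 2 * (C * ε) ^ 2 * (1 / (2 * ε)) ^ 2 := by
              gcongr
          _ = s ^ 2 * C ^ 2 / 4 := by field_simp; norm_num
      · rw [indicator_of_notMem ht, indicator_of_notMem ht]
        simp
    · have := Real.exp_pos (-|1 / 2 * t|)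
      linarith
    · rw [hI, eD, eK]
      congr 1
      ring
  have hlim : Tendsto (fun ε => ENNReal.ofReal (s ^ 2 * C ^ 2 / 4 * (2 * ε) + 1)) (𝓝[>] 0)
      (𝓝 (ENNReal.ofReal (s ^ 2 * C ^ 2 / 4 * (2 * 0) + 1))) :=
    ENNReal.tendsto_ofReal (tendsto_nhdsWithin_of_tendsto_nhds
      (((tendsto_id.const_mul 2).const_mul _).add_const 1))
  have := ge_of_tendsto hlim (by
    filter_upwards [Ioo_mem_nhdsGT hδ] with ε hε
    exact bound ε hε)
  simpa using this

theorem infEnergy_ne_top (hf : IsDegradation f ℓ ℓ₁) (s : ℝ) : infEnergy f s ≠ ⊤ :=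
  ne_top_of_le_ne_top ENNReal.one_ne_top (infEnergy_le_one hf s)

theorem g₀_le_one (hf : IsDegradation f ℓ ℓ₁) (s : ℝ) : g₀ f s ≤ 1 := by
  simpa [g₀] using ENNReal.toReal_mono ENNReal.one_ne_top (infEnergy_le_one hf s)

theorem g₀_nonneg (f : ℝ → ℝ) (s : ℝ) : 0 ≤ g₀ f s := ENNReal.toReal_nonneg

theorem monotoneOn_g₀ (hf : IsDegradation f ℓ ℓ₁) : MonotoneOn (g₀ f) (Ici 0) :=
  fun _ h₁ s₂ _ h => ENNReal.toReal_mono (infEnergy_ne_top hf s₂) (infEnergy_mono f h₁ h)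

/-- The opening is distributed proportionally to `u² + c u³`, which is the optimal density
`1 / f²(1 - u)` up to higher order terms. -/
theorem g₀_le_of_isProfile (hf : IsDegradation f ℓ ℓ₁) (hu : IsProfile u v)
    (hD : 0 < ∫ t, u t ^ 2) {m c : ℝ} (hm : ∀ t, u t ≤ m) (hm1 : m < 1) (hc : 0 ≤ c)
    (hcf : ∀ x ∈ Ioc 0 m, f₁ f x ≤ ℓ * (1 - c * x / 2)) (s : ℝ) :
    g₀ f s ≤ s ^ 2 * ℓ ^ 2 / ((∫ t, u t ^ 2) + c * ∫ t, u t ^ 3)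
      + (∫ t, u t ^ 2) / 4 + ∫ t, v t ^ 2 := by
  set N := (∫ t, u t ^ 2) + c * ∫ t, u t ^ 3 with hN
  have hN0 : 0 < N := by
    have := mul_nonneg hc hu.integral_cube_nonneg
    linarith
  let q : ℝ → ℝ := fun t => u t ^ 2 + c * u t ^ 3
  have hq0 : ∀ t, 0 ≤ q t := fun t => by
    have := hu.nonneg t
    positivity
  have hqi : Integrable q := hu.integrable_sq.add (hu.integrable_cube.const_mul c)
  have hqN : ∫ t, q t = N := by
    rw [hN, ← integral_const_mul, ← integral_add hu.integrable_sq (hu.integrable_cube.const_mul c)]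
  have hqc : Continuous q := (hu.continuous.pow 2).add (continuous_const.mul (hu.continuous.pow 3))
  have hL2 : IsL2Loc fun t => N⁻¹ * q t := hqc.isL2Loc.const_mul _
  have key := infEnergy_le_of_isProfile (s := s) hf.nonneg hu (fun t => (hm t).trans hm1.le) hL2
    (hqi.const_mul _) (by rw [integral_const_mul, hqN, inv_mul_cancel₀ hN0.ne'])
    (H := fun t => s ^ 2 * ℓ ^ 2 / N ^ 2 * q t) (hqi.const_mul _)
    (fun t => mul_nonneg (by positivity) (hq0 t)) (fun t ht => ?_) (fun t ht => by simp [q, ht])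
  · rw [integral_const_mul, hqN] at key
    have e : s ^ 2 * ℓ ^ 2 / N ^ 2 * N = s ^ 2 * ℓ ^ 2 / N := by field_simp
    rw [e] at key
    refine (ENNReal.toReal_mono ENNReal.ofReal_ne_top key).trans_eq (ENNReal.toReal_ofReal ?_)
    have h1 : 0 ≤ ∫ t, v t ^ 2 := integral_nonneg fun t => sq_nonneg _
    positivity
  · set x := u t
    have hx : x ∈ Ioc 0 m := ⟨ht, hm t⟩
    have hfx := hcf x hx
    have h0 := hf.f₁_nonneg ⟨ht, (hm t).trans hm1.le⟩
    have hy : 0 ≤ 1 - c * x / 2 := nonneg_of_mul_nonneg_right (h0.trans hfx) hf.slope_pos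
    have h2 : f₁ f x ^ 2 * (1 + c * x) ≤ ℓ ^ 2 := by
      have h3 : f₁ f x ^ 2 ≤ (ℓ * (1 - c * x / 2)) ^ 2 := pow_le_pow_left₀ h0 hfx 2
      have hcx : 0 ≤ c * x := mul_nonneg hc ht.le
      have h4 : (1 - c * x / 2) ^ 2 * (1 + c * x) ≤ 1 := by nlinarith [sq_nonneg (c * x)]
      calc f₁ f x ^ 2 * (1 + c * x) ≤ (ℓ * (1 - c * x / 2)) ^ 2 * (1 + c * x) := by gcongr
        _ = ℓ ^ 2 * ((1 - c * x / 2) ^ 2 * (1 + c * x)) := by ring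
        _ ≤ ℓ ^ 2 * 1 := by gcongr
        _ = ℓ ^ 2 := mul_one _
    have e1 : q t = x ^ 2 * (1 + c * x) := by simp only [q]; ring
    have e2 : s ^ 2 * f (1 - x) ^ 2 * (N⁻¹ * q t) ^ 2
        = s ^ 2 / N ^ 2 * q t * (f₁ f x ^ 2 * (1 + c * x)) := by
      rw [e1, f₁]
      field_simp
    have e3 : s ^ 2 * ℓ ^ 2 / N ^ 2 * q t = s ^ 2 / N ^ 2 * q t * ℓ ^ 2 := by ring
    rw [e2, e3]
    exact mul_le_mul_of_nonneg_left h2 (mul_nonneg (by positivity) (hq0 t))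

/-- The upper bound in the expansion of `g₀` at zero, from the test profiles `σ² u(σ ·)`. -/
theorem eventually_g₀_le (hf : IsDegradation f ℓ ℓ₁) {x : ℝ}
    (hx : x < cubicConst (ℓ₁ / (2 * ℓ))) :
    ∀ᶠ s in 𝓝[>] (0 : ℝ), g₀ f s ≤ ℓ * s - x * (2 * ℓ * s) ^ (5 / 3 : ℝ) := by
  have hℓ := hf.slope_pos
  have hℓ₁ := hf.slope_deriv_pos
  obtain ⟨u, v, hu, hD, hlt⟩ := exists_isProfile_lt hx
  set D := ∫ t, u t ^ 2
  set I := ∫ t, u t ^ 3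
  set K := ∫ t, v t ^ 2
  have hI0 : 0 ≤ I := hu.integral_cube_nonneg
  set P := D ^ (5 / 3 : ℝ)
  have hP : 0 < P := Real.rpow_pos_of_pos hD _
  rw [lt_div_iff₀ hP] at hlt
  -- lowering `κ` slightly makes room for the remainder in the expansion of `f₁`
  obtain ⟨κ, hκ0, hκ1, hκ⟩ : ∃ κ, 0 ≤ κ ∧ κ < ℓ₁ / (2 * ℓ) ∧ x * P < κ * I - K := by
    have h1 : Tendsto (fun κ => κ * I - K) (𝓝[<] (ℓ₁ / (2 * ℓ))) (𝓝 (ℓ₁ / (2 * ℓ) * I - K)) :=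
      tendsto_nhdsWithin_of_tendsto_nhds ((tendsto_id.mul_const I).sub_const K)
    have h2 : ∀ᶠ κ in 𝓝[<] (ℓ₁ / (2 * ℓ)), κ ∈ Ioo 0 (ℓ₁ / (2 * ℓ)) :=
      Ioo_mem_nhdsLT (by positivity)
    obtain ⟨κ, hk1, hk2⟩ := ((h1.eventually_const_lt hlt).and h2).exists
    exact ⟨κ, hk2.1.le, hk2.2, hk1⟩
  have hcℓ : 4 * κ * ℓ < 2 * ℓ₁ := by
    rw [lt_div_iff₀ (by positivity)] at hκ1
    linarith
  obtain ⟨m, hm, hmf⟩ := hf.exists_f₁_le hcℓ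
  obtain ⟨M, hM0, hM⟩ := hu.exists_bound
  -- the parameter `σ` is chosen so that `∫ u_σ² = σ³ D` equals `2 ℓ s`
  have main : ∀ᶠ σ in 𝓝[>] (0 : ℝ),
      g₀ f (σ ^ 3 * D / (2 * ℓ)) ≤ ℓ * (σ ^ 3 * D / (2 * ℓ)) - x * P * σ ^ 5 := by
    have h1 : ∀ᶠ σ in 𝓝[>] (0 : ℝ), σ ^ 2 * M < m := by
      have : Tendsto (fun σ : ℝ => σ ^ 2 * M) (𝓝[>] 0) (𝓝 (0 ^ 2 * M)) :=
        tendsto_nhdsWithin_of_tendsto_nhds ((tendsto_id.pow 2).mul_const M)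
      exact this.eventually_lt_const (by simpa using hm.1)
    have h2 : ∀ᶠ σ in 𝓝[>] (0 : ℝ), σ ^ 2 * (4 * κ ^ 2 * I ^ 2 / D) < κ * I - K - x * P := by
      have : Tendsto (fun σ : ℝ => σ ^ 2 * (4 * κ ^ 2 * I ^ 2 / D)) (𝓝[>] 0)
          (𝓝 (0 ^ 2 * (4 * κ ^ 2 * I ^ 2 / D))) :=
        tendsto_nhdsWithin_of_tendsto_nhds ((tendsto_id.pow 2).mul_const _)
      exact this.eventually_lt_const (by simpa using hκ)
    filter_upwards [h1, h2, self_mem_nhdsWithin] with σ hσ1 hσ2 hσ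
    have hσ : 0 < σ := hσ
    have hσu := hu.rescale (sq_nonneg σ) hσ
    have eD : ∫ t, (σ ^ 2 * u (σ * t)) ^ 2 = σ ^ 3 * D := by
      rw [IsProfile.integral_rescale_pow _ hσ]
      field_simp
      rfl
    have eI : ∫ t, (σ ^ 2 * u (σ * t)) ^ 3 = σ ^ 5 * I := by
      rw [IsProfile.integral_rescale_pow _ hσ]
      field_simp
      rfl
    have eK : ∫ t, (σ ^ 2 * (σ * v (σ * t))) ^ 2 = σ ^ 5 * K := by
      simp_rw [← mul_assoc]
      rw [IsProfile.integral_rescale_pow _ hσ]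
      field_simp
      rfl
    have key := g₀_le_of_isProfile hf hσu (by rw [eD]; positivity) (m := m) (c := 4 * κ)
      (fun t => (mul_le_mul_of_nonneg_left (hM _) (sq_nonneg σ)).trans hσ1.le) hm.2
      (by positivity) hmf (σ ^ 3 * D / (2 * ℓ))
    rw [eD, eI, eK] at key
    -- `σ³ z` is the cubic correction to `σ³ D` in the total mass of the density
    set z := 4 * κ * σ ^ 2 * I with hz
    have hz0 : 0 ≤ z := by positivity
    have e1 : (σ ^ 3 * D / (2 * ℓ)) ^ 2 * ℓ ^ 2 / (σ ^ 3 * D + 4 * κ * (σ ^ 5 * I))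
        = σ ^ 3 * (D ^ 2 / (4 * (D + z))) := by
      have : σ ^ 3 * D + 4 * κ * (σ ^ 5 * I) = σ ^ 3 * (D + z) := by rw [hz]; ring
      rw [this]
      field_simp
      norm_num
    have h3 : D ^ 2 / (4 * (D + z)) ≤ D / 4 - z / 4 + z ^ 2 / (4 * D) := by
      rw [div_le_iff₀ (by positivity)]
      have : (D / 4 - z / 4 + z ^ 2 / (4 * D)) * (4 * (D + z)) = D ^ 2 + z ^ 3 / D := by
        field_simp
        ring
      rw [this]
      have : 0 ≤ z ^ 3 / D := by positivity
      linarith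
    have h4 := mul_le_mul_of_nonneg_left h3 (pow_nonneg hσ.le 3)
    have e2 : σ ^ 3 * (D / 4 - z / 4 + z ^ 2 / (4 * D))
        = σ ^ 3 * D / 4 - σ ^ 5 * (κ * I) + σ ^ 5 * (σ ^ 2 * (4 * κ ^ 2 * I ^ 2 / D)) := by
      rw [hz]
      field_simp
    have h5 := mul_lt_mul_of_pos_left hσ2 (pow_pos hσ 5)
    have e3 : ℓ * (σ ^ 3 * D / (2 * ℓ)) = σ ^ 3 * D / 2 := by field_simp
    rw [e3]
    rw [e1] at key
    linarith
  have hσ : Tendsto (fun s : ℝ => (2 * ℓ * s / D) ^ (1 / 3 : ℝ)) (𝓝[>] 0) (𝓝[>] 0) := by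
    refine tendsto_nhdsWithin_iff.mpr ⟨?_, ?_⟩
    · have : Tendsto (fun s : ℝ => (2 * ℓ * s / D) ^ (1 / 3 : ℝ)) (𝓝 0)
          (𝓝 ((2 * ℓ * 0 / D) ^ (1 / 3 : ℝ))) :=
        ((tendsto_id.const_mul (2 * ℓ)).div_const D).rpow_const (Or.inr (by norm_num))
      rw [mul_zero, zero_div, Real.zero_rpow (by norm_num)] at this
      exact tendsto_nhdsWithin_of_tendsto_nhds this
    · filter_upwards [self_mem_nhdsWithin] with s hs
      have hs : 0 < s := hs
      exact Real.rpow_pos_of_pos (by positivity) _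
  filter_upwards [hσ.eventually main, self_mem_nhdsWithin] with s hs hs0
  have hs0 : 0 < s := hs0
  have hq : 0 ≤ 2 * ℓ * s / D := by positivity
  have e3 : ((2 * ℓ * s / D) ^ (1 / 3 : ℝ)) ^ 3 = 2 * ℓ * s / D := by
    rw [← Real.rpow_natCast, ← Real.rpow_mul hq]
    norm_num
  have e5 : P * ((2 * ℓ * s / D) ^ (1 / 3 : ℝ)) ^ 5 = (2 * ℓ * s) ^ (5 / 3 : ℝ) := by
    rw [← Real.rpow_natCast, ← Real.rpow_mul hq,
      show (1 / 3 : ℝ) * ((5 : ℕ) : ℝ) = 5 / 3 by norm_num, Real.div_rpow (by positivity) hD.le]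
    exact mul_div_cancel₀ _ hP.ne'
  have e6 : 2 * ℓ * s / D * D / (2 * ℓ) = s := by field_simp
  rwa [mul_assoc x, e5, e3, e6] at hs

end CohesiveFracture

/-! ### Subadditivity and the expansion at zero -/

namespace CohesiveFracture

variable {f : ℝ → ℝ} {ℓ ℓ₁ s c : ℝ}

/-- Subhomogeneity: stretching profiles does not increase the energy per unit of opening. -/
theorem mul_g₀_div_le (hf : IsDegradation f ℓ ℓ₁) (hc : 0 < c) (hc1 : c ≤ 1) (s : ℝ) :
    c * g₀ f (s / c) ≤ g₀ f s := by
  refine le_g₀ (infEnergy_ne_top hf s) fun α α' β β' hA hE => ?_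
  obtain ⟨hE', heq⟩ := profileEnergy_rescale hA hE hc
  have h1 := g₀_le_toReal (hA.rescale hc) hE'
  rw [heq, ← div_eq_inv_mul, le_div_iff₀ hc] at h1
  have h2 : 0 ≤ (1 - c ^ 2) * ∫ t, (- β' t) ^ 2 :=
    mul_nonneg (by nlinarith) (integral_nonneg fun t => sq_nonneg _)
  linarith

/-- The expansion at zero gives the bound for small `s`; subhomogeneity propagates it. -/
theorem g₀_lt_mul (hf : IsDegradation f ℓ ℓ₁) (hs : 0 < s) : g₀ f s < ℓ * s := by
  have hℓ := hf.slope_pos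
  have hℓ₁ := hf.slope_deriv_pos
  have hpos := cubicConst_pos (κ := ℓ₁ / (2 * ℓ)) (by positivity)
  obtain ⟨r, hr, hr0, hrs⟩ := ((eventually_g₀_le hf (half_lt_self hpos)).and
    (Ioo_mem_nhdsGT hs)).exists
  have h1 := mul_g₀_div_le hf (c := r / s) (by positivity) ((div_le_one hs).mpr hrs.le) r
  rw [div_div_cancel₀ hr0.ne', div_mul_eq_mul_div, div_le_iff₀ hs] at h1
  have h2 : g₀ f r < ℓ * r := by
    have : 0 < cubicConst (ℓ₁ / (2 * ℓ)) / 2 * (2 * ℓ * r) ^ (5 / 3 : ℝ) :=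
      mul_pos (by positivity) (Real.rpow_pos_of_pos (by positivity) _)
    linarith
  nlinarith

theorem g₀_zero (hf : IsDegradation f ℓ ℓ₁) : g₀ f 0 = 0 := by
  refine le_antisymm ?_ (g₀_nonneg f 0)
  have h1 : Tendsto (fun s : ℝ => ℓ * s) (𝓝[>] 0) (𝓝 (ℓ * 0)) :=
    tendsto_nhdsWithin_of_tendsto_nhds (tendsto_id.const_mul ℓ)
  rw [mul_zero] at h1
  refine ge_of_tendsto h1 ?_
  filter_upwards [self_mem_nhdsWithin] with s hs
  exact (monotoneOn_g₀ hf self_mem_Ici (mem_Ici.mpr (le_of_lt hs)) (le_of_lt hs)).trans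
    (g₀_lt_mul hf hs).le

theorem g₀_le_mul (hf : IsDegradation f ℓ ℓ₁) (hs : 0 ≤ s) : g₀ f s ≤ ℓ * s := by
  rcases hs.lt_or_eq with hs | rfl
  · exact (g₀_lt_mul hf hs).le
  · rw [g₀_zero hf, mul_zero]

/-- Strict subhomogeneity. Since `g₀ s < ℓ s`, profiles of nearly optimal energy have a height
bounded from below, so that their gradient energy, which decreases under stretching, is bounded
from below too. -/
theorem mul_g₀_div_lt (hf : IsDegradation f ℓ ℓ₁) (hs : 0 < s) (hc : 0 < c) (hc1 : c < 1) :
    c * g₀ f (s / c) < g₀ f s := by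
  obtain ⟨r, hr, hr0, hr1⟩ : ∃ r, g₀ f s < s * f₁ f r ∧ 0 < r ∧ r < 1 := by
    have h1 : Tendsto (fun r => s * f₁ f r) (𝓝[>] 0) (𝓝 (s * ℓ)) := hf.tendsto_f₁.const_mul s
    have h2 : g₀ f s < s * ℓ := by linarith [g₀_lt_mul hf hs]
    obtain ⟨r, h3, h4⟩ := ((h1.eventually_const_lt h2).and (Ioo_mem_nhdsGT one_pos)).exists
    exact ⟨r, h3, h4.1, h4.2⟩
  have hsr : 0 < s * f₁ f r := (g₀_nonneg f s).trans_lt hr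
  -- `k` bounds the gradient energy from below
  set k := r ^ 4 / (4 * (s * f₁ f r)) with hk
  have hk0 : 0 < k := by positivity
  have hc2 : 0 < 1 - c ^ 2 := by nlinarith
  by_contra! hcon
  obtain ⟨α, α', β, β', hA, hE, hlt⟩ := exists_lt_of_g₀_lt (infEnergy_ne_top hf s)
    (x := min (s * f₁ f r) (g₀ f s + (1 - c ^ 2) * k))
    (lt_min hr (by have := mul_pos hc2 hk0; linarith))
  set E := (profileEnergy f s α' β β').toReal
  have hP := hA.isProfile hE
  obtain ⟨t, ht⟩ : ∃ t, r < 1 - β t := by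
    by_contra! hall
    have := hA.mul_f₁_le hf hs hE ⟨hr0, hr1.le⟩ hall
    linarith [hlt.trans_le (min_le_left _ _)]
  have hK0 : 0 ≤ ∫ t, (- β' t) ^ 2 := integral_nonneg fun t => sq_nonneg _
  have hD : ∫ t, (1 - β t) ^ 2 ≤ 4 * (s * f₁ f r) := by
    linarith [hA.phase_le hf.nonneg hs hE, hlt.trans_le (min_le_left _ _)]
  have hkK : k ≤ ∫ t, (- β' t) ^ 2 := by
    rw [hk, div_le_iff₀' (by positivity)]
    calc r ^ 4 ≤ (1 - β t) ^ 4 := pow_le_pow_left₀ hr0.le ht.le 4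
      _ ≤ _ := hP.pow_four_le t
      _ ≤ _ := mul_le_mul_of_nonneg_right hD hK0
  obtain ⟨hE', heq⟩ := profileEnergy_rescale hA hE hc
  have h1 := g₀_le_toReal (hA.rescale hc) hE'
  rw [heq, ← div_eq_inv_mul, le_div_iff₀ hc] at h1
  have h2 := mul_le_mul_of_nonneg_left hkK hc2.le
  linarith [hlt.trans_le (min_le_right _ _)]

theorem g₀_add_lt (hf : IsDegradation f ℓ ℓ₁) {s₁ s₂ : ℝ} (h₁ : 0 < s₁) (h₂ : 0 < s₂) :
    g₀ f (s₁ + s₂) < g₀ f s₁ + g₀ f s₂ := by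
  have hs : 0 < s₁ + s₂ := by positivity
  have key : ∀ r, 0 < r → r < s₁ + s₂ → r / (s₁ + s₂) * g₀ f (s₁ + s₂) < g₀ f r := by
    intro r hr hlt
    have := mul_g₀_div_lt hf hr (c := r / (s₁ + s₂)) (by positivity) ((div_lt_one hs).mpr hlt)
    rwa [div_div_cancel₀ hr.ne'] at this
  have e : s₁ / (s₁ + s₂) * g₀ f (s₁ + s₂) + s₂ / (s₁ + s₂) * g₀ f (s₁ + s₂) = g₀ f (s₁ + s₂) := by
    field_simp
  linarith [key s₁ h₁ (by linarith), key s₂ h₂ (by linarith)]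

theorem g₀_add_le (hf : IsDegradation f ℓ ℓ₁) {s₁ s₂ : ℝ} (h₁ : 0 ≤ s₁) (h₂ : 0 ≤ s₂) :
    g₀ f (s₁ + s₂) ≤ g₀ f s₁ + g₀ f s₂ := by
  rcases h₁.lt_or_eq with h₁ | rfl
  · rcases h₂.lt_or_eq with h₂ | rfl
    · exact (g₀_add_lt hf h₁ h₂).le
    · rw [add_zero, g₀_zero hf, add_zero]
  · rw [zero_add, g₀_zero hf, zero_add]

theorem lipschitzOnWith_g₀ (hf : IsDegradation f ℓ ℓ₁) :
    LipschitzOnWith (Real.toNNReal ℓ) (g₀ f) (Ici 0) := by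
  refine LipschitzOnWith.of_le_add_mul _ fun x hx y hy => ?_
  rw [Real.coe_toNNReal _ hf.slope_pos.le, Real.dist_eq]
  have hx : 0 ≤ x := hx
  have hy : 0 ≤ y := hy
  calc g₀ f x ≤ g₀ f (y + |x - y|) :=
        monotoneOn_g₀ hf hx (add_nonneg hy (abs_nonneg _)) (by linarith [le_abs_self (x - y)])
    _ ≤ g₀ f y + g₀ f |x - y| := g₀_add_le hf hy (abs_nonneg _)
    _ ≤ g₀ f y + ℓ * |x - y| := by gcongr; exact g₀_le_mul hf (abs_nonneg _)

/-- Either the profile reaches the height `r`, or its elastic energy is at least `s f₁(r)`. -/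
theorem min_le_g₀ (hf : IsDegradation f ℓ ℓ₁) (hs : 0 < s) {r : ℝ} (hr : r ∈ Ioc (0 : ℝ) 1) :
    min (r ^ 2) (s * f₁ f r) ≤ g₀ f s := by
  refine le_g₀ (infEnergy_ne_top hf s) fun α α' β β' hA hE => ?_
  by_cases h : ∀ t, 1 - β t ≤ r
  · exact (min_le_right _ _).trans (hA.mul_f₁_le hf hs hE hr h)
  · push Not at h
    obtain ⟨t, ht⟩ := h
    calc min (r ^ 2) (s * f₁ f r) ≤ r ^ 2 := min_le_left _ _
      _ ≤ (1 - β t) ^ 2 := pow_le_pow_left₀ hr.1.le ht.le 2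
      _ ≤ _ := (hA.isProfile hE).sq_le t
      _ ≤ _ := hA.phase_le hf.nonneg hs hE

theorem tendsto_g₀_atTop (hf : IsDegradation f ℓ ℓ₁) : Tendsto (g₀ f) atTop (𝓝 1) := by
  refine tendsto_order.mpr ⟨fun a ha => ?_, fun a ha =>
    Eventually.of_forall fun s => (g₀_le_one hf s).trans_lt ha⟩
  obtain ⟨r, hra, hr⟩ : ∃ r : ℝ, a < r ^ 2 ∧ r ∈ Ioo (0 : ℝ) 1 := by
    have h1 : Tendsto (fun r : ℝ => r ^ 2) (𝓝[<] 1) (𝓝 (1 ^ 2)) :=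
      tendsto_nhdsWithin_of_tendsto_nhds (tendsto_id.pow 2)
    exact ((h1.eventually_const_lt (by simpa using ha)).and (Ioo_mem_nhdsLT one_pos)).exists
  filter_upwards [(tendsto_id.atTop_mul_const (hf.f₁_pos hr)).eventually_gt_atTop a,
    eventually_gt_atTop 0] with s hs hs0
  exact (lt_min hra hs).trans_le (min_le_g₀ hf hs0 ⟨hr.1, hr.2.le⟩)

/-- The lower bound in the expansion of `g₀` at zero. By comparison with `ℓ s`, the profile has
height at most `√(ℓ s)` and `∫ u²` is at most `2 ℓ s` to leading order; linearisation reduces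
the energy to `ℓ s - κ ∫ u³ + ∫ u'²`. -/
theorem eventually_le_g₀ (hf : IsDegradation f ℓ ℓ₁) {x : ℝ}
    (hx : cubicConst (ℓ₁ / (2 * ℓ)) < x) :
    ∀ᶠ s in 𝓝[>] (0 : ℝ), ℓ * s - x * (2 * ℓ * s) ^ (5 / 3 : ℝ) ≤ g₀ f s := by
  have hℓ := hf.slope_pos
  have hℓ₁ := hf.slope_deriv_pos
  -- `κ`, `τ` and `μ` absorb, respectively, the remainder in the expansion of `f₁`, the excess of
  -- `∫ u²` over `2 ℓ s`, and the distance of `μ` from its optimal value `1 / 2`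
  obtain ⟨κ, hκ, hκx⟩ : ∃ κ, ℓ₁ / (2 * ℓ) < κ ∧ cubicConst κ < x := by
    have h1 : Tendsto cubicConst (𝓝[>] (ℓ₁ / (2 * ℓ))) (𝓝 (cubicConst (ℓ₁ / (2 * ℓ)))) :=
      continuous_cubicConst.continuousWithinAt
    obtain ⟨κ, h2, h3⟩ := ((h1.eventually_lt_const hx).and self_mem_nhdsWithin).exists
    exact ⟨κ, h3, h2⟩
  have hκ0 : 0 < κ := lt_trans (by positivity) hκ
  have hΦ := cubicConst_pos hκ0
  obtain ⟨τ, hτ1, hτ⟩ : ∃ τ : ℝ, 1 < τ ∧ cubicConst κ * τ ^ (5 / 3 : ℝ) < x := by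
    have h1 : Tendsto (fun τ : ℝ => cubicConst κ * τ ^ (5 / 3 : ℝ)) (𝓝[>] 1)
        (𝓝 (cubicConst κ * 1 ^ (5 / 3 : ℝ))) :=
      tendsto_nhdsWithin_of_tendsto_nhds
        ((tendsto_id.rpow_const (Or.inr (by norm_num))).const_mul _)
    rw [Real.one_rpow, mul_one] at h1
    obtain ⟨τ, h2, h3⟩ := ((h1.eventually_lt_const hκx).and self_mem_nhdsWithin).exists
    exact ⟨τ, h3, h2⟩
  obtain ⟨μ, hμ0, hμ1, hμτ⟩ : ∃ μ : ℝ, 0 < μ ∧ μ < 1 / 2 ∧ 1 < (1 / 2 + μ) * τ := by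
    have h1 : Tendsto (fun μ : ℝ => (1 / 2 + μ) * τ) (𝓝[<] (1 / 2)) (𝓝 ((1 / 2 + 1 / 2) * τ)) :=
      tendsto_nhdsWithin_of_tendsto_nhds ((tendsto_id.const_add _).mul_const τ)
    obtain ⟨μ, h2, h3⟩ := ((h1.eventually_const_lt
      (show (1 : ℝ) < (1 / 2 + 1 / 2) * τ by linarith)).and
      (Ioo_mem_nhdsLT (by norm_num : (0 : ℝ) < 1 / 2))).exists
    exact ⟨μ, h3.1, h3.2, h2⟩
  have hc : 2 * ℓ₁ < 4 * κ * ℓ := by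
    rw [div_lt_iff₀ (by positivity)] at hκ
    linarith
  obtain ⟨m, hm, hmf⟩ := hf.exists_sq_le_f₁_sq_mul hc
  have hsqrt : Tendsto (fun s : ℝ => √(ℓ * s)) (𝓝[>] 0) (𝓝 0) := by
    have : Tendsto (fun s : ℝ => √(ℓ * s)) (𝓝 0) (𝓝 √(ℓ * 0)) :=
      (tendsto_id.const_mul ℓ).sqrt
    rw [mul_zero, Real.sqrt_zero] at this
    exact tendsto_nhdsWithin_of_tendsto_nhds this
  have ev1 : ∀ᶠ s in 𝓝[>] (0 : ℝ), √(ℓ * s) < m := hsqrt.eventually_lt_const hm.1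
  have ev2 : ∀ᶠ s in 𝓝[>] (0 : ℝ),
      1 - 2 * μ < (1 / 4 - μ ^ 2 * (1 + 4 * κ * √(ℓ * s))) * (2 * τ) := by
    have : Tendsto (fun s : ℝ => (1 / 4 - μ ^ 2 * (1 + 4 * κ * √(ℓ * s))) * (2 * τ)) (𝓝[>] 0)
        (𝓝 ((1 / 4 - μ ^ 2 * (1 + 4 * κ * 0)) * (2 * τ))) :=
      ((((hsqrt.const_mul _).const_add 1).const_mul _).const_sub _).mul_const _
    refine this.eventually_const_lt ?_
    have h1 : 0 < 1 - 2 * μ := by linarith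
    nlinarith [mul_lt_mul_of_pos_left hμτ h1]
  filter_upwards [ev1, ev2, self_mem_nhdsWithin] with s hs1 hs2 hs
  have hs : 0 < s := hs
  by_contra! hcon
  obtain ⟨α, α', β, β', hA, hE, hlt⟩ := exists_lt_of_g₀_lt (infEnergy_ne_top hf s) hcon
  have hP := hA.isProfile hE
  have hQ : 0 < (2 * ℓ * s) ^ (5 / 3 : ℝ) := Real.rpow_pos_of_pos (by positivity) _
  have hx0 : 0 < x := hΦ.trans hκx
  have hEs : (profileEnergy f s α' β β').toReal < ℓ * s := by
    have := mul_pos hx0 hQ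
    linarith
  have hheight : ∀ t, 1 - β t ≤ √(ℓ * s) := fun t =>
    Real.le_sqrt_of_sq_le (((hP.sq_le t).trans (hA.phase_le hf.nonneg hs hE)).trans hEs.le)
  have hcx : ∀ y ∈ Ioc 0 √(ℓ * s), ℓ ^ 2 ≤ f₁ f y ^ 2 * (1 + 4 * κ * y) := fun y hy =>
    hmf y ⟨hy.1, hy.2.trans hs1.le⟩
  have hlin := fun {μ : ℝ} (h : 0 ≤ μ) =>
    hA.linearised_le hf hs hE hheight (hs1.trans hm.2) h hcx
  have hcube := hP.integral_cube_le hheight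
  have hD0 : 0 ≤ ∫ t, (1 - β t) ^ 2 := integral_nonneg fun t => sq_nonneg _
  have hK0 : 0 ≤ ∫ t, (- β' t) ^ 2 := integral_nonneg fun t => sq_nonneg _
  have hfin := hP.mul_integral_cube_le κ
  set D := ∫ t, (1 - β t) ^ 2
  set I := ∫ t, (1 - β t) ^ 3
  set K := ∫ t, (- β' t) ^ 2
  set w := √(ℓ * s)
  -- `D (1 / 4 - μ²) ≤ (1 - 2 μ) ℓ s` up to the small term with `w`
  have hDle : D ≤ 2 * ℓ * s * τ := by
    have h1 := hlin hμ0.le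
    have h2 : μ ^ 2 * (4 * κ * I) ≤ μ ^ 2 * (4 * κ * (w * D)) := by gcongr
    have h3 : (1 / 4 - μ ^ 2 * (1 + 4 * κ * w)) * D ≤ (1 - 2 * μ) * (ℓ * s) := by nlinarith
    have h4 : 0 < 1 / 4 - μ ^ 2 * (1 + 4 * κ * w) := by
      have : 0 < (1 / 4 - μ ^ 2 * (1 + 4 * κ * w)) * (2 * τ) := by linarith
      exact pos_of_mul_pos_left this (by positivity)
    have h5 : (1 - 2 * μ) * (ℓ * s)
        ≤ (1 / 4 - μ ^ 2 * (1 + 4 * κ * w)) * (2 * τ) * (ℓ * s) :=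
      mul_le_mul_of_nonneg_right hs2.le (by positivity)
    refine le_of_mul_le_mul_left (a := 1 / 4 - μ ^ 2 * (1 + 4 * κ * w)) ?_ h4
    linarith
  have hDpow : D ^ (5 / 3 : ℝ) ≤ (2 * ℓ * s) ^ (5 / 3 : ℝ) * τ ^ (5 / 3 : ℝ) := by
    rw [← Real.mul_rpow (by positivity) (by positivity)]
    exact Real.rpow_le_rpow hD0 hDle (by norm_num)
  have h6 := mul_le_mul_of_nonneg_left hDpow hΦ.le
  have h7 := mul_lt_mul_of_pos_right hτ hQ
  -- for `μ = 1 / 2` the terms with `D` cancel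
  have h8 := hlin (μ := 1 / 2) (by norm_num)
  linarith

theorem isLittleO_g₀ (hf : IsDegradation f ℓ ℓ₁) :
    (fun s : ℝ => g₀ f s -
        (ℓ * s - cubicConst (ℓ₁ / (2 * ℓ)) * (2 * ℓ) ^ (5 / 3 : ℝ) * s ^ (5 / 3 : ℝ)))
      =o[𝓝[>] 0] (fun s : ℝ => s ^ (5 / 3 : ℝ)) := by
  have hℓ := hf.slope_pos
  set Φ := cubicConst (ℓ₁ / (2 * ℓ))
  set q := (2 * ℓ) ^ (5 / 3 : ℝ)
  have hq : 0 < q := Real.rpow_pos_of_pos (by positivity) _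
  refine isLittleO_iff.mpr fun ε hε => ?_
  have hδ : 0 < ε / q := by positivity
  filter_upwards [eventually_g₀_le hf (sub_lt_self Φ hδ),
    eventually_le_g₀ hf (lt_add_of_pos_right Φ hδ),
    self_mem_nhdsWithin] with s h1 h2 hs
  have hs : 0 < s := hs
  have hs3 : 0 < s ^ (5 / 3 : ℝ) := Real.rpow_pos_of_pos hs _
  rw [Real.mul_rpow (by positivity) hs.le] at h1 h2
  rw [Real.norm_eq_abs, Real.norm_of_nonneg hs3.le, abs_le]
  have e : ε / q * (q * s ^ (5 / 3 : ℝ)) = ε * s ^ (5 / 3 : ℝ) := by field_simp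
  constructor <;> linarith

end CohesiveFracture

theorem theorem6p1 (f : ℝ → ℝ) (ℓ ℓ₁ : ℝ) (hf : CohesiveFracture.IsDegradation f ℓ ℓ₁) :
    (∀ s : ℝ, 0 ≤ s → CohesiveFracture.infEnergy f s ≠ ⊤) ∧
    MonotoneOn (CohesiveFracture.g₀ f) (Set.Ici 0) ∧
    (∀ s : ℝ, 0 ≤ s → CohesiveFracture.g₀ f s ≤ min 1 (ℓ * s)) ∧
    Filter.Tendsto (CohesiveFracture.g₀ f) Filter.atTop (nhds 1) ∧
    (∃ ℓ' : ℝ, 0 < ℓ' ∧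
      (fun s : ℝ => CohesiveFracture.g₀ f s - (ℓ * s - ℓ' * s ^ (5 / 3 : ℝ)))
        =o[nhdsWithin 0 (Set.Ioi 0)] (fun s : ℝ => s ^ (5 / 3 : ℝ))) ∧
    (∀ s₁ s₂ : ℝ, 0 ≤ s₁ → 0 ≤ s₂ →
      CohesiveFracture.g₀ f (s₁ + s₂) ≤ CohesiveFracture.g₀ f s₁ + CohesiveFracture.g₀ f s₂) ∧
    (∀ s₁ s₂ : ℝ, 0 < s₁ → 0 < s₂ →
      CohesiveFracture.g₀ f (s₁ + s₂) < CohesiveFracture.g₀ f s₁ + CohesiveFracture.g₀ f s₂) ∧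
    LipschitzOnWith (Real.toNNReal ℓ) (CohesiveFracture.g₀ f) (Set.Ici 0) := by
  have hℓ := hf.slope_pos
  have hℓ₁ := hf.slope_deriv_pos
  refine ⟨fun s _ => CohesiveFracture.infEnergy_ne_top hf s, CohesiveFracture.monotoneOn_g₀ hf,
    fun s hs => le_min (CohesiveFracture.g₀_le_one hf s) (CohesiveFracture.g₀_le_mul hf hs),
    CohesiveFracture.tendsto_g₀_atTop hf, ⟨_, ?_, CohesiveFracture.isLittleO_g₀ hf⟩,
    fun _ _ h₁ h₂ => CohesiveFracture.g₀_add_le hf h₁ h₂,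
    fun _ _ h₁ h₂ => CohesiveFracture.g₀_add_lt hf h₁ h₂, CohesiveFracture.lipschitzOnWith_g₀ hf⟩
  exact mul_pos (CohesiveFracture.cubicConst_pos (by positivity))
    (Real.rpow_pos_of_pos (by positivity) _)
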